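/- Let $(X,\mathcal B,m)$ be a $\sigma$-finite measure space with $m(X)=\infty$ and let $T:X\to X$ be an invertible (bi-measurable) measure preserving transformation which is conservative and ergodic. Write $S_n(f)=\sum_{k=0}^{n-1}f\circ T^k$ and $\Sigma_n(f)=\sum_{|k|<n}f\circ T^k$, and for $A\in\mathcal B$ with $0<m(A)<\infty$ put $a_n(A)=\sum_{k=0}^{n-1}\frac{m(A\cap T^{-k}A)}{m(A)^2}$. Assume that $T$ is boundedly rationally ergodic, i.e. there are $A\in\mathcal B$ with $0<m(A)<\infty$ and $M<\infty$ such that for every $n\ge 1$, $S_n(1_A)\le M\,a_n(A)$ a.e. on $A$; for such a set $A$ the sequence $a_n(T):=a_n(A)$ is called the return sequence of $T$ (up to asymptotic equivalence it does not depend on $A$). Then there are constants $\underline\beta(T),\overline\beta(T)\in\mathbb R$ such that, for every such choice of the return sequence and every nonnegative $f\in L_1(X,m)$, for $m$-a.e. $x$, $$\limsup_{n\to\infty}\frac{\Sigma_n(f)(x)}{2a_n(T)}=\overline\beta(T)\int_X f\,dm,\qquad \liminf_{n\to\infty}\frac{\Sigma_n(f)(x)}{2a_n(T)}=\underline\beta(T)\int_X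 f\,dm,$$ and $$\overline\beta(T)-\underline\beta(T)\ge\frac1{5000}.$$ -/

import Mathlib

open MeasureTheory Filter

noncomputable section

namespace SymmetricBirkhoff

/-- The symmetric (two-sided) Birkhoff sum `Σ_n(f)(x) = ∑_{|k| < n} f (T^k x)`, the sum being over
integers `k`, of an invertible transformation `T`. -/
def symmSum {X : Type*} [MeasurableSpace X] (T : X ≃ᵐ X) (f : X → ℝ) (n : ℕ) (x : X) : ℝ :=
  ∑ k ∈ Finset.Ioo (-(n : ℤ)) (n : ℤ), f (((T.toEquiv : Equiv.Perm X) ^ k) x)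

/-- `a_n(A) = ∑_{k=0}^{n-1} m(A ∩ T^{-k} A) / m(A)^2`. -/
def returnSeq {X : Type*} [MeasurableSpace X] (T : X ≃ᵐ X) (m : Measure X) (A : Set X) (n : ℕ) :
    ℝ :=
  ∑ k ∈ Finset.range n, m.real (A ∩ (T : X → X)^[k] ⁻¹' A) / m.real A ^ 2

/-- The sets which witness bounded rational ergodicity: measurable, of positive finite measure and
such that for some `M < ∞`, for all `n ≥ 1`, `S_n(1_A) ≤ M a_n(A)` a.e. on `A`. -/
structure IsBRESet {X : Type*} [MeasurableSpace X] (T : X ≃ᵐ X) (m : Measure X) (A : Set X) :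
    Prop where
  measurableSet : MeasurableSet A
  measure_pos : 0 < m A
  measure_lt_top : m A < ⊤
  exists_bound : ∃ M : ℝ, ∀ n : ℕ, 1 ≤ n → ∀ᵐ x ∂(m.restrict A),
    birkhoffSum T (A.indicator fun _ => (1 : ℝ)) n x ≤ M * returnSeq T m A n

/-- Bounded rational ergodicity. (Conservativity, ergodicity and invariance of the measure are
separate hypotheses.) -/
def BoundedlyRationallyErgodic {X : Type*} [MeasurableSpace X] (T : X ≃ᵐ X) (m : Measure X) :
    Prop :=
  ∃ A : Set X, IsBRESet T m A

/-- `a` is a version of the return sequence `a_n(T)`: it is `a_n(A)` for a set `A` witnessing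
bounded rational ergodicity. -/
def IsReturnSequence {X : Type*} [MeasurableSpace X] (T : X ≃ᵐ X) (m : Measure X) (a : ℕ → ℝ) :
    Prop :=
  ∃ A : Set X, IsBRESet T m A ∧ a = returnSeq T m A

/-- `β` is the constant `β̄(T)`: for the return sequence (whichever set defines it) and every
nonnegative integrable `f`, `limsup Σ_n(f) / (2 a_n(T)) = β ∫ f` a.e. The limit superior is taken
in the extended reals, so its finiteness is part of the claim. -/
def IsUpperBeta {X : Type*} [MeasurableSpace X] (T : X ≃ᵐ X) (m : Measure X) (β : ℝ) : Prop :=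
  ∀ a : ℕ → ℝ, IsReturnSequence T m a → ∀ f : X → ℝ, Integrable f m → 0 ≤ᵐ[m] f →
    ∀ᵐ x ∂m, limsup (fun n : ℕ => ((symmSum T f n x / (2 * a n) : ℝ) : EReal)) atTop
      = ((β * ∫ y, f y ∂m : ℝ) : EReal)

/-- `β` is the constant `β̲(T)`: the same with the limit inferior. -/
def IsLowerBeta {X : Type*} [MeasurableSpace X] (T : X ≃ᵐ X) (m : Measure X) (β : ℝ) : Prop :=
  ∀ a : ℕ → ℝ, IsReturnSequence T m a → ∀ f : X → ℝ, Integrable f m → 0 ≤ᵐ[m] f →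
    ∀ᵐ x ∂m, liminf (fun n : ℕ => ((symmSum T f n x / (2 * a n) : ℝ) : EReal)) atTop
      = ((β * ∫ y, f y ∂m : ℝ) : EReal)

end SymmetricBirkhoff

end

namespace SymmetricBirkhoff

open Topology

/-! ### Limits superior and inferior of real sequences in `EReal`. -/

section Limsup

/-! Existence of the constants. The bound S_n(1_A) ≤ M a_n spreads from A to almost all of X and to
`T.symm`. By the maximal ergodic theorem, Birkhoff sums of a function of integral zero are then
o(a_n) (`ae_tendsto_birkhoffSum_div`). Hence f may be replaced by a multiple of 1_A, the return
sequences of two witnesses are asymptotic (`IsBoundedSet.tendsto_returnSeq_div`), and the limsup and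
liminf for 1_A, being T-invariant and bounded, are finite constants.

The difference. Reverse Fatou gives an upper constant at least 1
(`IsBoundedSet.measure_le_of_limsup`). If the two constants were closer than 1/5000, some increasing
b_n, a multiple of a_n, would satisfy 0.99 b_n ≤ Σ_n(1_A) ≤ b_n for all n ≥ N on a set G filling 99
percent of A.

Because m(X) = ∞, there are points of G preceded by a long stretch of k steps with few visits to A
compared with a_{k+1} (`IsBoundedSet.exists_sparse_gap`): otherwise a renewal inequality would bound
gap lengths by an integrable visit count and make the total measure finite. Let y be such a point, ℓ
= k+1, and F(n) the number of visits of y to A in n forward steps. The past contributes little, so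
F(n) is about b_n for N ≤ n ≤ ℓ, with error relative to b_ℓ. If T^s y lies in G, the window of
radius s around it gives F(2s) ≈ b_s ≈ F(s).

Take such times s, r with F(s) ≈ b_ℓ and F(r) ≈ (3/5) b_ℓ. Then 2r < s, and the window of radius s-r
around T^s y lies between times r and 2s, so it holds about (2/5) b_ℓ visits at most; but its radius
is at least r, which requires about b_r ≈ (3/5) b_ℓ. This is the contradiction of
`false_of_window_counts`. -/

theorem limsup_coe_le_of_tendsto_sub {u v : ℕ → ℝ} (h : Tendsto (fun n => v n - u n) atTop (𝓝 0)) :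
    limsup (fun n => (v n : EReal)) atTop ≤ limsup (fun n => (u n : EReal)) atTop := by
  have h0 : limsup (fun n => ((v n - u n : ℝ) : EReal)) atTop = 0 := by
    have : Tendsto (fun n => ((v n - u n : ℝ) : EReal)) atTop (𝓝 ((0 : ℝ) : EReal)) :=
      (continuous_coe_real_ereal.tendsto 0).comp h
    simpa using this.limsup_eq
  have h1 : (fun n => (v n : EReal)) =
      (fun n => (u n : EReal)) + fun n => ((v n - u n : ℝ) : EReal) := by
    funext n
    rw [Pi.add_apply, ← EReal.coe_add]
    congr 1
    ring
  rw [h1]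
  refine (EReal.limsup_add_le (.inr ?_) (.inr ?_)).trans ?_
  · rw [h0]; exact EReal.zero_ne_top
  · rw [h0]; exact EReal.zero_ne_bot
  · rw [h0, add_zero]

theorem limsup_coe_congr_of_tendsto_sub {u v : ℕ → ℝ}
    (h : Tendsto (fun n => v n - u n) atTop (𝓝 0)) :
    limsup (fun n => (v n : EReal)) atTop = limsup (fun n => (u n : EReal)) atTop := by
  refine le_antisymm (limsup_coe_le_of_tendsto_sub h) (limsup_coe_le_of_tendsto_sub ?_)
  simpa using h.neg

theorem limsup_coe_eq_of_tendsto_sub_mul {u v : ℕ → ℝ} {c β : ℝ} (hc : 0 ≤ c)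
    (hu : limsup (fun n => (u n : EReal)) atTop = β)
    (h : Tendsto (fun n => v n - c * u n) atTop (𝓝 0)) :
    limsup (fun n => (v n : EReal)) atTop = ((β * c : ℝ) : EReal) := by
  rw [limsup_coe_congr_of_tendsto_sub h]
  have := EReal.limsup_const_mul_of_nonneg_of_ne_top (f := atTop) (u := fun n : ℕ => (u n : EReal))
    (c := (c : EReal)) (by exact_mod_cast hc) (EReal.coe_ne_top c)
  simp only [EReal.coe_mul]
  rw [this, hu, mul_comm]

theorem liminf_coe_eq_neg_limsup (u : ℕ → ℝ) :
    liminf (fun n => (u n : EReal)) atTop = -limsup (fun n => ((-u n : ℝ) : EReal)) atTop := by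
  rw [← EReal.liminf_neg]
  congr 1
  funext n
  simp

theorem liminf_coe_eq_of_tendsto_sub_mul {u v : ℕ → ℝ} {c β : ℝ} (hc : 0 ≤ c)
    (hu : liminf (fun n => (u n : EReal)) atTop = β)
    (h : Tendsto (fun n => v n - c * u n) atTop (𝓝 0)) :
    liminf (fun n => (v n : EReal)) atTop = ((β * c : ℝ) : EReal) := by
  rw [liminf_coe_eq_neg_limsup] at hu ⊢
  rw [limsup_coe_eq_of_tendsto_sub_mul (u := fun n => -u n) (β := -β) hc]
  · rw [← EReal.coe_neg]; congr 1; ring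
  · rw [EReal.coe_neg, ← hu, neg_neg]
  · have := h.neg
    simp only [neg_zero] at this
    convert this using 2
    ring

end Limsup

/-! ### The maximal ergodic theorem and sums of functions of integral zero. -/

section Maximal

variable {X : Type*} {f : X → X} {h : X → ℝ}

/-- The maximal function `max (0, S_1 h, …, S_N h)` of the Birkhoff sums. -/
noncomputable def birkhoffMax (f : X → X) (h : X → ℝ) : ℕ → X → ℝ
  | 0 => fun _ => 0
  | N + 1 => fun x => max 0 (h x + birkhoffMax f h N (f x))

theorem birkhoffMax_nonneg (N : ℕ) (x : X) : 0 ≤ birkhoffMax f h N x := by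
  cases N with
  | zero => exact le_rfl
  | succ N => exact le_max_left _ _

theorem birkhoffMax_le_succ (N : ℕ) (x : X) : birkhoffMax f h N x ≤ birkhoffMax f h (N + 1) x := by
  induction N generalizing x with
  | zero => exact birkhoffMax_nonneg _ _
  | succ N ih => exact max_le_max le_rfl (add_le_add le_rfl (ih _))

theorem birkhoffSum_le_birkhoffMax (N : ℕ) (x : X) : birkhoffSum f h N x ≤ birkhoffMax f h N x := by
  induction N generalizing x with
  | zero => simp [birkhoffMax]
  | succ N ih =>
    rw [birkhoffSum_succ']
    exact (add_le_add le_rfl (ih _)).trans (le_max_right _ _)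

variable [MeasurableSpace X] {m : Measure X}

theorem integrable_birkhoffMax (hf : MeasurePreserving f m m) (hh : Integrable h m) (N : ℕ) :
    Integrable (birkhoffMax f h N) m := by
  induction N with
  | zero => exact integrable_zero _ _ _
  | succ N ih =>
    exact (integrable_zero X ℝ m).sup (hh.add (hf.integrable_comp_of_integrable ih))

theorem measurable_birkhoffMax (hf : Measurable f) (hh : Measurable h) (N : ℕ) :
    Measurable (birkhoffMax f h N) := by
  induction N with
  | zero => exact measurable_const
  | succ N ih => exact measurable_const.max (hh.add (ih.comp hf))

/-- The maximal ergodic theorem. -/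
theorem integral_indicator_birkhoffMax_pos_nonneg (hf : MeasurePreserving f m m)
    (hm : Measurable h) (hh : Integrable h m) (N : ℕ) :
    0 ≤ ∫ x, {x | 0 < birkhoffMax f h (N + 1) x}.indicator h x ∂m := by
  have hI := integrable_birkhoffMax hf hh (N + 1)
  have hI' := hf.integrable_comp_of_integrable hI
  have h0 : ∫ x, (birkhoffMax f h (N + 1) x - (birkhoffMax f h (N + 1) ∘ f) x) ∂m = 0 := by
    rw [integral_sub hI hI', sub_eq_zero]
    have := integral_map (μ := m) (φ := f) hf.measurable.aemeasurable
      (f := birkhoffMax f h (N + 1)) (by rw [hf.map_eq]; exact hI.aestronglyMeasurable)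
    rw [hf.map_eq] at this
    exact this
  refine h0.symm.le.trans ?_
  have hmeas : MeasurableSet {x | 0 < birkhoffMax f h (N + 1) x} :=
    measurableSet_lt measurable_const (measurable_birkhoffMax hf.measurable hm _)
  refine integral_mono (hI.sub hI') (hh.indicator hmeas) fun x => ?_
  by_cases hx : 0 < birkhoffMax f h (N + 1) x
  · simp only [Set.indicator, Set.mem_ofPred_eq, hx, if_true, Function.comp]
    have h1 : birkhoffMax f h (N + 1) x = h x + birkhoffMax f h N (f x) := by
      have : birkhoffMax f h (N + 1) x = max 0 (h x + birkhoffMax f h N (f x)) := rfl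
      rw [this] at hx ⊢
      rcases lt_max_iff.1 hx with h2 | h2
      · exact absurd h2 (lt_irrefl _)
      · exact max_eq_right h2.le
    have h2 := birkhoffMax_le_succ (f := f) (h := h) N (f x)
    linarith
  · simp only [Set.indicator, Set.mem_ofPred_eq, hx, if_false, Function.comp]
    have h2 := birkhoffMax_nonneg (f := f) (h := h) (N + 1) (f x)
    linarith [not_lt.1 hx]

theorem measurable_birkhoffSum (hf : Measurable f) (hh : Measurable h) (n : ℕ) :
    Measurable (birkhoffSum f h n) :=
  Finset.measurable_sum _ fun k _ => hh.comp (hf.iterate k)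

/-- The set of points with sums bounded above is invariant, so it is null or conull. If it were
null, almost every point would have a positive Birkhoff sum, the sets where `birkhoffMax` is
positive would exhaust X, and the maximal inequality would give `0 ≤ ∫ h` in the limit. -/
theorem ae_bddAbove_birkhoffSum_of_measurable (hf : Ergodic f m) (hm : Measurable h)
    (hh : Integrable h m) (hneg : ∫ x, h x ∂m < 0) :
    ∀ᵐ x ∂m, ∃ C : ℕ, ∀ n, birkhoffSum f h n x ≤ C := by
  set E : Set X := {x | ∃ C : ℕ, ∀ n, birkhoffSum f h n x ≤ C} with hE
  have hEm : MeasurableSet E := by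
    have : E = ⋃ C : ℕ, ⋂ n : ℕ, {x | birkhoffSum f h n x ≤ C} := by
      ext x; simp [hE]
    rw [this]
    exact MeasurableSet.iUnion fun C => MeasurableSet.iInter fun n =>
      measurableSet_le (measurable_birkhoffSum hf.measurable hm n) measurable_const
  have hinv : f ⁻¹' E = E := by
    ext x
    simp only [hE, Set.mem_preimage, Set.mem_ofPred_eq]
    constructor
    · rintro ⟨C, hC⟩
      obtain ⟨D, hD⟩ := exists_nat_ge (max 0 (h x + C))
      refine ⟨D, fun n => ?_⟩
      cases n with
      | zero => simp
      | succ n =>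
        rw [birkhoffSum_succ']
        exact le_trans (by linarith [hC n]) ((le_max_right _ _).trans hD)
    · rintro ⟨C, hC⟩
      obtain ⟨D, hD⟩ := exists_nat_ge (C - h x)
      refine ⟨D, fun n => ?_⟩
      have := hC (n + 1)
      rw [birkhoffSum_succ'] at this
      linarith
  rcases hf.toPreErgodic.ae_mem_or_ae_notMem hEm hinv with h1 | h1
  · exact h1
  exfalso
  have hlim : Tendsto (fun N : ℕ => ∫ x, {x | 0 < birkhoffMax f h (N + 1) x}.indicator h x ∂m)
      atTop (𝓝 (∫ x, h x ∂m)) := by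
    refine tendsto_integral_of_dominated_convergence (fun x => ‖h x‖) (fun N => ?_) hh.norm
      (fun N => ae_of_all _ fun x => norm_indicator_le_norm_self _ _) ?_
    · exact (hm.indicator (measurableSet_lt measurable_const
        (measurable_birkhoffMax hf.measurable hm _))).aestronglyMeasurable
    · filter_upwards [h1] with x hx
      simp only [hE, Set.mem_ofPred_eq, not_exists, not_forall, not_le] at hx
      obtain ⟨n, hn⟩ := hx 0
      have hmono : Monotone fun N => birkhoffMax f h N x :=
        monotone_nat_of_le_succ fun N => birkhoffMax_le_succ N x
      refine tendsto_const_nhds.congr' ?_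
      filter_upwards [eventually_ge_atTop n] with N hN
      rw [Set.indicator_of_mem]
      have h2 := birkhoffSum_le_birkhoffMax (f := f) (h := h) n x
      have h3 := hmono (show n ≤ N + 1 by omega)
      simp only [Set.mem_ofPred_eq]
      simp only [Nat.cast_zero] at hn
      exact hn.trans_le (h2.trans h3)
  exact absurd (ge_of_tendsto' hlim fun N =>
    integral_indicator_birkhoffMax_pos_nonneg hf.toMeasurePreserving hm hh N) (not_le.2 hneg)

theorem ae_forall_iterate (hf : Measure.QuasiMeasurePreserving f m m) {p : X → Prop}
    (hp : ∀ᵐ x ∂m, p x) : ∀ᵐ x ∂m, ∀ k, p (f^[k] x) :=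
  ae_all_iff.2 fun k => (hf.iterate k).ae hp

theorem ae_bddAbove_birkhoffSum (hf : Ergodic f m)
    (hh : Integrable h m) (hneg : ∫ x, h x ∂m < 0) :
    ∀ᵐ x ∂m, ∃ C : ℕ, ∀ n, birkhoffSum f h n x ≤ C := by
  set g := hh.aestronglyMeasurable.mk h with hg
  have hgm : Measurable g := hh.aestronglyMeasurable.stronglyMeasurable_mk.measurable
  have hae : h =ᵐ[m] g := hh.aestronglyMeasurable.ae_eq_mk
  have := ae_bddAbove_birkhoffSum_of_measurable hf hgm (hh.congr hae)
    (by rwa [← integral_congr_ae hae])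
  filter_upwards [this, ae_forall_iterate hf.quasiMeasurePreserving hae] with x ⟨C, hC⟩ hx
  refine ⟨C, fun n => ?_⟩
  have : birkhoffSum f h n x = birkhoffSum f g n x := Finset.sum_congr rfl fun k _ => hx k
  rw [this]
  exact hC n

/-- If `h` has integral zero, its Birkhoff sums are negligible with respect to any sequence
tending to infinity which dominates the Birkhoff sums of some `g` with `∫ g > 0`. -/
theorem ae_tendsto_birkhoffSum_div (hf : Ergodic f m) {g : X → ℝ} (hg : Integrable g m)
    (hgpos : 0 < ∫ x, g x ∂m) {a : ℕ → ℝ} (ha : Tendsto a atTop atTop) {M : ℝ}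
    (hM : ∀ᵐ x ∂m, ∀ n, birkhoffSum f g n x ≤ M * a n)
    (hh : Integrable h m) (h0 : ∫ x, h x ∂m = 0) :
    ∀ᵐ x ∂m, Tendsto (fun n => birkhoffSum f h n x / a n) atTop (𝓝 0) := by
  have key : ∀ h : X → ℝ, Integrable h m → ∫ x, h x ∂m = 0 → ∀ᵐ x ∂m, ∀ j : ℕ, ∃ C : ℕ, ∀ n,
      birkhoffSum f h n x ≤ (1 / (j + 1 : ℝ)) * (M * a n) + C := by
    intro h hh h0
    refine ae_all_iff.2 fun j => ?_
    have hj : (0 : ℝ) < 1 / (j + 1 : ℝ) := by positivity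
    -- Subtracting a small multiple of `g` makes the integral negative, so the sums of `h` exceed
    -- those of this multiple by at most a constant.
    have hI : Integrable (fun x => h x - (1 / (j + 1 : ℝ)) * g x) m := hh.sub (hg.const_mul _)
    have hneg : ∫ x, (h x - (1 / (j + 1 : ℝ)) * g x) ∂m < 0 := by
      rw [integral_sub hh (hg.const_mul _), h0, integral_const_mul]
      nlinarith [mul_pos hj hgpos]
    filter_upwards [ae_bddAbove_birkhoffSum hf hI hneg, hM] with x ⟨C, hC⟩ hx
    refine ⟨C, fun n => ?_⟩
    have h1 := hC n
    have h2 : birkhoffSum f (fun x => h x - (1 / (j + 1 : ℝ)) * g x) n x =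
        birkhoffSum f h n x - (1 / (j + 1 : ℝ)) * birkhoffSum f g n x := by
      simp only [birkhoffSum, Finset.sum_sub_distrib, Finset.mul_sum]
    rw [h2] at h1
    have h3 := mul_le_mul_of_nonneg_left (hx n) hj.le
    linarith
  have hnegI : ∫ x, (-h) x ∂m = 0 := by
    simp only [Pi.neg_apply]
    rw [integral_neg, h0, neg_zero]
  filter_upwards [key h hh h0, key (-h) hh.neg hnegI] with x h1 h2
  rw [Metric.tendsto_atTop']
  intro ε hε
  obtain ⟨j, hj⟩ : ∃ j : ℕ, |M| / (j + 1 : ℝ) < ε / 2 := by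
    obtain ⟨j, hj⟩ := exists_nat_gt (|M| / (ε / 2))
    refine ⟨j, ?_⟩
    rw [div_lt_iff₀ (by positivity)] at hj ⊢
    nlinarith
  obtain ⟨C, hC⟩ := h1 j
  obtain ⟨D, hD⟩ := h2 j
  obtain ⟨N, hN⟩ := (tendsto_atTop.1 ha (2 * (C + D + 1) / ε + 1)).exists_forall_of_atTop
  refine ⟨N, fun n hn => ?_⟩
  have han := hN n hn.le
  have hapos : 0 < a n := lt_of_lt_of_le (by positivity) han
  have hCD : (C + D : ℝ) < ε / 2 * a n := by
    have : 2 * (C + D + 1) / ε < a n := by linarith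
    rw [div_lt_iff₀ hε] at this
    linarith
  have hMa : (1 / (j + 1 : ℝ)) * (M * a n) ≤ ε / 2 * a n := by
    have : (1 / (j + 1 : ℝ)) * M ≤ ε / 2 := by
      refine le_trans ?_ hj.le
      rw [div_mul_eq_mul_div, one_mul]
      gcongr
      exact le_abs_self M
    nlinarith
  have h3 := hC n
  have h4 := hD n
  rw [birkhoffSum_neg] at h4
  have hCn : (0 : ℝ) ≤ C := Nat.cast_nonneg _
  have hDn : (0 : ℝ) ≤ D := Nat.cast_nonneg _
  rw [Real.dist_eq, sub_zero, abs_div, abs_of_pos hapos, div_lt_iff₀ hapos, abs_lt]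
  constructor <;> linarith

end Maximal

/-! ### Visits to a set, return sequences and the bound on the whole space. -/

section Visits

variable {X : Type*} {A B : Set X}

/-- Real-valued indicator function of a set. -/
noncomputable abbrev ind (A : Set X) : X → ℝ := A.indicator fun _ => (1 : ℝ)

theorem ind_nonneg (A : Set X) (x : X) : 0 ≤ ind A x :=
  Set.indicator_nonneg (fun _ _ => zero_le_one) x

theorem ind_le_one (A : Set X) (x : X) : ind A x ≤ 1 :=
  Set.indicator_le_self' (fun _ _ => zero_le_one) x

theorem ind_of_mem {x : X} (h : x ∈ A) : ind A x = 1 := Set.indicator_of_mem h _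

theorem ind_of_notMem {x : X} (h : x ∉ A) : ind A x = 0 := Set.indicator_of_notMem h _

theorem birkhoffSum_ind_nonneg (f : X → X) (A : Set X) (n : ℕ) (x : X) :
    0 ≤ birkhoffSum f (ind A) n x :=
  Finset.sum_nonneg fun _ _ => ind_nonneg _ _

theorem birkhoffSum_ind_mono (f : X → X) (h : C ⊆ A) (n : ℕ) (x : X) :
    birkhoffSum f (ind C) n x ≤ birkhoffSum f (ind A) n x :=
  Finset.sum_le_sum fun _ _ => Set.indicator_le_indicator_of_subset h (fun _ => zero_le_one) _

theorem monotone_birkhoffSum_ind (f : X → X) (A : Set X) (x : X) :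
    Monotone fun n => birkhoffSum f (ind A) n x :=
  monotone_nat_of_le_succ fun n => by
    rw [birkhoffSum_succ]
    linarith [ind_nonneg A (f^[n] x)]

theorem tendsto_birkhoffSum_ind {f : X → X} {x : X} (h : ∃ᶠ n in atTop, f^[n] x ∈ A) :
    Tendsto (fun n => birkhoffSum f (ind A) n x) atTop atTop := by
  refine tendsto_atTop_atTop_of_monotone (monotone_birkhoffSum_ind f A x) fun b => ?_
  have : ∀ j : ℕ, ∃ n, (j : ℝ) ≤ birkhoffSum f (ind A) n x := by
    intro j
    induction j with
    | zero => exact ⟨0, by simp⟩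
    | succ j ih =>
      obtain ⟨n, hn⟩ := ih
      obtain ⟨k, hk, hkA⟩ := frequently_atTop.1 h n
      refine ⟨k + 1, ?_⟩
      rw [birkhoffSum_succ, ind_of_mem hkA]
      have := monotone_birkhoffSum_ind f A x hk
      push_cast
      simp only at this
      linarith
  obtain ⟨j, hj⟩ := exists_nat_ge b
  obtain ⟨n, hn⟩ := this j
  exact ⟨n, hj.trans hn⟩

variable [MeasurableSpace X] {m : Measure X}

theorem measurable_ind (hA : MeasurableSet A) : Measurable (ind A) := measurable_const.indicator hA

theorem integrable_ind (hA : MeasurableSet A) (hA' : m A < ⊤) : Integrable (ind A) m :=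
  (integrable_indicator_iff hA).2 (integrableOn_const hA'.ne)

theorem integral_ind (hA : MeasurableSet A) : ∫ x, ind A x ∂m = m.real A := by
  rw [integral_indicator hA]; simp

/-- The set of points with infinitely many visits is invariant, and by conservativity it contains
almost all of `A`; ergodicity makes it conull. -/
theorem ae_frequently_mem {f : X → X} (hf : Ergodic f m) (hc : Conservative f m)
    (hA : MeasurableSet A) (h0 : m A ≠ 0) : ∀ᵐ x ∂m, ∃ᶠ n in atTop, f^[n] x ∈ A := by
  have hE : MeasurableSet {x | ∃ᶠ n in atTop, f^[n] x ∈ A} := by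
    have : {x | ∃ᶠ n in atTop, f^[n] x ∈ A} = ⋂ N : ℕ, ⋃ n ≥ N, f^[n] ⁻¹' A := by
      ext x; simp [frequently_atTop]
    rw [this]
    exact MeasurableSet.iInter fun N => MeasurableSet.iUnion fun n => MeasurableSet.iUnion fun _ =>
      hf.measurable.iterate n hA
  have hinv : f ⁻¹' {x | ∃ᶠ n in atTop, f^[n] x ∈ A} = {x | ∃ᶠ n in atTop, f^[n] x ∈ A} := by
    ext x
    simp only [Set.mem_preimage, Set.mem_ofPred_eq, ← Function.iterate_succ_apply]
    simp only [frequently_atTop]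
    constructor
    · intro h N
      obtain ⟨n, hn, h⟩ := h N
      exact ⟨n + 1, by omega, h⟩
    · intro h N
      obtain ⟨n, hn, h⟩ := h (N + 1)
      exact ⟨n - 1, by omega, by rwa [Nat.succ_eq_add_one, Nat.sub_add_cancel (by omega)]⟩
  rcases hf.toPreErgodic.ae_mem_or_ae_notMem hE hinv with h | h
  · exact h
  · exfalso
    refine h0 (measure_eq_zero_iff_ae_notMem.2 ?_)
    filter_upwards [h, hc.ae_mem_imp_frequently_image_mem hA.nullMeasurableSet] with x h1 h2 h3
    exact h1 (h2 h3)

theorem conservative_symm {T : X ≃ᵐ X} (hT : MeasurePreserving T m m) (hc : Conservative T m) :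
    Conservative T.symm m where
  toQuasiMeasurePreserving := (hT.symm T).quasiMeasurePreserving
  exists_mem_iterate_mem' := by
    intro s hs h0
    obtain ⟨x, hx, k, hk, hxk⟩ := hc.exists_mem_iterate_mem hs.nullMeasurableSet h0
    refine ⟨T^[k] x, hxk, k, hk, ?_⟩
    have : Function.LeftInverse T.symm^[k] T^[k] :=
      Function.LeftInverse.iterate T.symm_apply_apply k
    rwa [this x]

theorem symm_iterate_iterate (T : X ≃ᵐ X) (k : ℕ) (x : X) : T.symm^[k] (T^[k] x) = x :=
  Function.LeftInverse.iterate T.symm_apply_apply k x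

theorem iterate_symm_iterate (T : X ≃ᵐ X) (k : ℕ) (x : X) : T^[k] (T.symm^[k] x) = x :=
  Function.LeftInverse.iterate T.apply_symm_apply k x

theorem measure_inter_preimage_iterate {T : X ≃ᵐ X} (hT : MeasurePreserving T m m)
    (hA : MeasurableSet A) (hB : MeasurableSet B) (k : ℕ) :
    m (A ∩ T^[k] ⁻¹' B) = m (B ∩ T.symm^[k] ⁻¹' A) := by
  have h := ((hT.symm T).iterate k).measure_preimage
    (hA.inter (T.measurable.iterate k hB)).nullMeasurableSet
  rw [← h]
  congr 1
  ext x
  simp [iterate_symm_iterate, and_comm]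

theorem integral_birkhoffSum_ind {T : X ≃ᵐ X} (hA' : m A < ⊤)
    (hB : MeasurableSet B) (n : ℕ) :
    ∫ x in A, birkhoffSum T (ind B) n x ∂m =
      ∑ k ∈ Finset.range n, m.real (A ∩ T^[k] ⁻¹' B) := by
  have : IsFiniteMeasure (m.restrict A) := ⟨by simpa using hA'⟩
  simp only [birkhoffSum]
  rw [integral_finsetSum]
  · refine Finset.sum_congr rfl fun k _ => ?_
    have h1 : ∀ x, ind B (T^[k] x) = ind (T^[k] ⁻¹' B) x := fun x => rfl
    simp only [h1]
    rw [integral_ind (T.measurable.iterate k hB), Measure.real,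
      Measure.restrict_apply (T.measurable.iterate k hB), Set.inter_comm, Measure.real]
  · intro k _
    have h1 : ∀ x, ind B (T^[k] x) = ind (T^[k] ⁻¹' B) x := fun x => rfl
    simp only [h1]
    exact integrable_ind (T.measurable.iterate k hB) (measure_lt_top _ _)

theorem sum_measure_inter_eq (T : X ≃ᵐ X) (h0 : 0 < m A) (ht : m A < ⊤) (n : ℕ) :
    ∑ k ∈ Finset.range n, m.real (A ∩ T^[k] ⁻¹' A) = returnSeq T m A n * m.real A ^ 2 := by
  have : m.real A ≠ 0 := (ENNReal.toReal_pos h0.ne' ht.ne).ne'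
  rw [returnSeq, ← Finset.sum_div, div_mul_cancel₀]
  positivity

theorem returnSeq_nonneg (T : X ≃ᵐ X) (m : Measure X) (A : Set X) (n : ℕ) :
    0 ≤ returnSeq T m A n :=
  Finset.sum_nonneg fun _ _ => by positivity

theorem monotone_returnSeq (T : X ≃ᵐ X) (m : Measure X) (A : Set X) :
    Monotone (returnSeq T m A) :=
  monotone_nat_of_le_succ fun n => by
    rw [returnSeq, returnSeq, Finset.sum_range_succ]
    have : 0 ≤ m.real (A ∩ T^[n] ⁻¹' A) / m.real A ^ 2 := by positivity
    linarith

theorem returnSeq_symm {T : X ≃ᵐ X} (hT : MeasurePreserving T m m) (hA : MeasurableSet A) (n : ℕ) :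
    returnSeq T.symm m A n = returnSeq T m A n :=
  Finset.sum_congr rfl fun k _ => by
    rw [Measure.real, ← measure_inter_preimage_iterate hT hA hA, ← Measure.real]

/-- A set of positive finite measure whose visits are bounded, almost everywhere on the whole
space, by a multiple of its return sequence. -/
structure IsBoundedSet (T : X ≃ᵐ X) (m : Measure X) (A : Set X) (M : ℝ) : Prop where
  measurableSet : MeasurableSet A
  measure_pos : 0 < m A
  measure_lt_top : m A < ⊤
  bound : ∀ᵐ x ∂m, ∀ n, birkhoffSum T (ind A) n x ≤ M * returnSeq T m A n

theorem IsBoundedSet.real_pos {T : X ≃ᵐ X} {M : ℝ} (h : IsBoundedSet T m A M) : 0 < m.real A :=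
  ENNReal.toReal_pos h.measure_pos.ne' h.measure_lt_top.ne

/-- No visit is counted before the first entry to `A`, so the count from any point is at most the
count of equal length started at the entry point, where the hypothesis applies. -/
theorem IsBRESet.exists_isBoundedSet {T : X ≃ᵐ X} (hT : MeasurePreserving T m m)
    (h : IsBRESet T m A) : ∃ M, IsBoundedSet T m A M := by
  obtain ⟨M, hM⟩ := h.exists_bound
  -- The absolute value keeps the bound nonnegative for orbits that do not meet `A` before time `n`.
  refine ⟨|M|, h.measurableSet, h.measure_pos, h.measure_lt_top, ?_⟩
  have h1 : ∀ᵐ x ∂m, x ∈ A → ∀ n : ℕ, 1 ≤ n →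
      birkhoffSum T (ind A) n x ≤ M * returnSeq T m A n := by
    rw [← ae_restrict_iff' h.measurableSet, ae_all_iff]
    intro n
    by_cases hn : 1 ≤ n
    · simpa [hn] using hM n hn
    · simp [hn]
  filter_upwards [ae_forall_iterate hT.quasiMeasurePreserving h1] with x hx n
  have hr : 0 ≤ |M| * returnSeq T m A n := mul_nonneg (abs_nonneg _) (returnSeq_nonneg _ _ _ _)
  by_cases hv : ∃ j, j < n ∧ T^[j] x ∈ A
  · classical
    obtain ⟨hj, hjA⟩ := Nat.find_spec hv
    set j := Nat.find hv
    have hmin : ∀ i < j, T^[i] x ∉ A := fun i hi hiA =>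
      Nat.find_min hv hi ⟨hi.trans hj, hiA⟩
    have h2 : birkhoffSum T (ind A) n x = birkhoffSum T (ind A) (n - j) (T^[j] x) := by
      have h3 : birkhoffSum T (ind A) j x = 0 :=
        Finset.sum_eq_zero fun i hi => ind_of_notMem (hmin i (Finset.mem_range.1 hi))
      have h4 := birkhoffSum_add T (ind A) j (n - j) x
      rw [Nat.add_sub_of_le hj.le, h3, zero_add] at h4
      exact h4
    rw [h2]
    refine (monotone_birkhoffSum_ind T A (T^[j] x) (Nat.sub_le n j)).trans ?_
    refine (hx j hjA n (by omega)).trans ?_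
    exact mul_le_mul_of_nonneg_right (le_abs_self M) (returnSeq_nonneg _ _ _ _)
  · push Not at hv
    have : birkhoffSum T (ind A) n x = 0 :=
      Finset.sum_eq_zero fun i hi => ind_of_notMem (hv i (Finset.mem_range.1 hi))
    rw [this]
    exact hr

/-- Both sides run over the same orbit segment, in opposite orders. This transfers the bound for `T`
to `T.symm`. -/
theorem birkhoffSum_symm_eq (T : X ≃ᵐ X) (f : X → ℝ) (n : ℕ) (x : X) :
    birkhoffSum T.symm f (n + 1) x = birkhoffSum T f (n + 1) (T.symm^[n] x) := by
  simp only [birkhoffSum]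
  rw [← Finset.sum_range_reflect]
  refine Finset.sum_congr rfl fun k hk => ?_
  have hk' : k ≤ n := Nat.lt_succ_iff.1 (Finset.mem_range.1 hk)
  congr 1
  have h1 : n + 1 - 1 - k = n - k := by omega
  rw [h1]
  conv_rhs => rw [show n = k + (n - k) by omega, Function.iterate_add_apply, iterate_symm_iterate]

theorem IsBoundedSet.symm {T : X ≃ᵐ X} {M : ℝ} (hT : MeasurePreserving T m m)
    (h : IsBoundedSet T m A M) : IsBoundedSet T.symm m A M where
  measurableSet := h.measurableSet
  measure_pos := h.measure_pos
  measure_lt_top := h.measure_lt_top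
  bound := by
    filter_upwards [ae_forall_iterate (hT.symm T).quasiMeasurePreserving h.bound] with x hx n
    rw [returnSeq_symm hT h.measurableSet]
    cases n with
    | zero => simp [returnSeq]
    | succ n =>
      rw [birkhoffSum_symm_eq]
      exact hx n (n + 1)

/-- Allows one witness to be moved until it overlaps another without changing its return sequence.
-/
theorem IsBoundedSet.preimage_iterate {T : X ≃ᵐ X} {M : ℝ} (hT : MeasurePreserving T m m)
    (h : IsBoundedSet T m A M) (k : ℕ) : IsBoundedSet T m (T^[k] ⁻¹' A) M ∧
      returnSeq T m (T^[k] ⁻¹' A) = returnSeq T m A := by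
  have hm : m (T^[k] ⁻¹' A) = m A := (hT.iterate k).measure_preimage h.measurableSet.nullMeasurableSet
  have hr : returnSeq T m (T^[k] ⁻¹' A) = returnSeq T m A := by
    funext n
    refine Finset.sum_congr rfl fun j _ => ?_
    have h1 : T^[k] ⁻¹' A ∩ T^[j] ⁻¹' (T^[k] ⁻¹' A) = T^[k] ⁻¹' (A ∩ T^[j] ⁻¹' A) := by
      ext x
      simp only [Set.mem_inter_iff, Set.mem_preimage, ← Function.iterate_add_apply]
      rw [add_comm]
    have h2 : m (T^[k] ⁻¹' (A ∩ T^[j] ⁻¹' A)) = m (A ∩ T^[j] ⁻¹' A) :=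
      (hT.iterate k).measure_preimage
        (h.measurableSet.inter (T.measurable.iterate j h.measurableSet)).nullMeasurableSet
    simp only [Measure.real, h1, h2, hm]
  refine ⟨⟨T.measurable.iterate k h.measurableSet, hm ▸ h.measure_pos, hm ▸ h.measure_lt_top, ?_⟩,
    hr⟩
  filter_upwards [ae_forall_iterate hT.quasiMeasurePreserving h.bound] with x hx n
  rw [hr]
  have : birkhoffSum T (ind (T^[k] ⁻¹' A)) n x = birkhoffSum T (ind A) n (T^[k] x) := by
    refine Finset.sum_congr rfl fun j _ => ?_
    have h1 : ind (T^[k] ⁻¹' A) (T^[j] x) = ind A (T^[k] (T^[j] x)) := rfl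
    rw [h1, ← Function.iterate_add_apply, ← Function.iterate_add_apply, add_comm]
  rw [this]
  exact hx k n

/-- Almost every orbit visits `A` infinitely often, so its counts diverge, and they are dominated by
`M` times the nonnegative return sequence. -/
theorem IsBoundedSet.pos_and_tendsto {T : X ≃ᵐ X} {M : ℝ} (h : IsBoundedSet T m A M)
    (hT : Ergodic T m) (hc : Conservative T m) :
    0 < M ∧ Tendsto (returnSeq T m A) atTop atTop := by
  have hne : (ae m).NeBot := by
    rw [ae_neBot]
    rintro rfl
    simpa using h.measure_pos
  obtain ⟨x, h1, h2⟩ :=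
    ((ae_frequently_mem hT hc h.measurableSet h.measure_pos.ne').and h.bound).exists
  have h3 := tendsto_atTop_mono h2 (tendsto_birkhoffSum_ind h1)
  have hM : 0 < M := by
    obtain ⟨n, hn⟩ := (h3.eventually_gt_atTop 0).exists
    exact pos_of_mul_pos_left hn (returnSeq_nonneg _ _ _ _)
  exact ⟨hM, (tendsto_const_mul_atTop_of_pos hM).1 h3⟩

end Visits

/-! ### Two-sided sums as forward plus backward sums. -/

section SymmSum

variable {X : Type*} [MeasurableSpace X] {m : Measure X} {A B : Set X}

theorem zpow_natCast_apply (T : X ≃ᵐ X) (k : ℕ) (x : X) :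
    ((T.toEquiv : Equiv.Perm X) ^ (k : ℤ)) x = T^[k] x := by
  rw [zpow_natCast, Equiv.Perm.iterate_eq_pow T.toEquiv k |>.symm]
  rfl

theorem zpow_neg_natCast_apply (T : X ≃ᵐ X) (k : ℕ) (x : X) :
    ((T.toEquiv : Equiv.Perm X) ^ (-(k : ℤ))) x = T.symm^[k] x := by
  have h : ((T.toEquiv : Equiv.Perm X) ^ (-(k : ℤ))) = ((T.toEquiv : Equiv.Perm X)⁻¹) ^ k := by
    rw [zpow_neg, zpow_natCast, inv_pow]
  rw [h, Equiv.Perm.iterate_eq_pow _ k |>.symm]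
  rfl

/-- The index 0 belongs to both one-sided sums, hence the subtracted `f x`; for empty sums this
correction would be wrong, hence `n + 1`. -/
theorem symmSum_succ_eq (T : X ≃ᵐ X) (f : X → ℝ) (n : ℕ) (x : X) :
    symmSum T f (n + 1) x = birkhoffSum T f (n + 1) x + birkhoffSum T.symm f (n + 1) x - f x := by
  induction n with
  | zero =>
    have : Finset.Ioo (-((0 + 1 : ℕ) : ℤ)) ((0 + 1 : ℕ) : ℤ) = {0} := by decide
    rw [symmSum, this]
    simp
  | succ n ih =>
    have : Finset.Ioo (-((n + 1 + 1 : ℕ) : ℤ)) ((n + 1 + 1 : ℕ) : ℤ) =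
        insert ((n + 1 : ℕ) : ℤ) (insert (-((n + 1 : ℕ) : ℤ))
          (Finset.Ioo (-((n + 1 : ℕ) : ℤ)) ((n + 1 : ℕ) : ℤ))) := by
      ext k
      simp only [Finset.mem_Ioo, Finset.mem_insert]
      omega
    rw [symmSum, this, Finset.sum_insert, Finset.sum_insert, zpow_natCast_apply,
      zpow_neg_natCast_apply, birkhoffSum_succ _ _ (n + 1), birkhoffSum_succ _ _ (n + 1)]
    · have h2 : ∑ k ∈ Finset.Ioo (-((n + 1 : ℕ) : ℤ)) ((n + 1 : ℕ) : ℤ),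
          f (((T.toEquiv : Equiv.Perm X) ^ k) x) = symmSum T f (n + 1) x := rfl
      rw [h2, ih]
      ring
    · simp
    · simp only [Finset.mem_insert, Finset.mem_Ioo]
      omega

theorem symmSum_ind_nonneg (T : X ≃ᵐ X) (A : Set X) (n : ℕ) (x : X) :
    0 ≤ symmSum T (ind A) n x :=
  Finset.sum_nonneg fun _ _ => ind_nonneg _ _

theorem measurable_zpow (T : X ≃ᵐ X) (k : ℤ) :
    Measurable fun x => ((T.toEquiv : Equiv.Perm X) ^ k) x := by
  obtain ⟨n, rfl | rfl⟩ := k.eq_nat_or_neg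
  · simp only [zpow_natCast_apply]; exact T.measurable.iterate n
  · simp only [zpow_neg_natCast_apply]; exact T.symm.measurable.iterate n

theorem measurable_symmSum (T : X ≃ᵐ X) {f : X → ℝ} (hf : Measurable f) (n : ℕ) :
    Measurable (symmSum T f n) :=
  Finset.measurable_sum _ fun k _ => hf.comp (measurable_zpow T k)

theorem symmSum_sub_const_mul (T : X ≃ᵐ X) (f g : X → ℝ) (c : ℝ) (n : ℕ) (x : X) :
    symmSum T (fun y => f y - c * g y) n x = symmSum T f n x - c * symmSum T g n x := by
  simp only [symmSum, Finset.sum_sub_distrib, Finset.mul_sum]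

theorem IsBoundedSet.ae_tendsto_symmSum_div {T : X ≃ᵐ X} {M : ℝ} (h : IsBoundedSet T m A M)
    (hT : Ergodic T m) (hc : Conservative T m) {f : X → ℝ} (hf : Integrable f m)
    (h0 : ∫ x, f x ∂m = 0) :
    ∀ᵐ x ∂m, Tendsto (fun n => symmSum T f n x / (2 * returnSeq T m A n)) atTop (𝓝 0) := by
  have ha := (h.pos_and_tendsto hT hc).2
  have hI := integrable_ind h.measurableSet h.measure_lt_top
  have hpos : 0 < ∫ x, ind A x ∂m := by rw [integral_ind h.measurableSet]; exact h.real_pos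
  have hs := h.symm hT.toMeasurePreserving
  have hr : returnSeq T.symm m A = returnSeq T m A :=
    funext fun n => returnSeq_symm hT.toMeasurePreserving h.measurableSet n
  have hsb := hs.bound
  rw [hr] at hsb
  filter_upwards [ae_tendsto_birkhoffSum_div hT hI hpos ha h.bound hf h0,
    ae_tendsto_birkhoffSum_div hT.symm hI hpos ha hsb hf h0] with x h1 h2
  have h3 : Tendsto (fun n => f x / returnSeq T m A n) atTop (𝓝 0) := ha.const_div_atTop _
  have h4 := ((h1.add h2).sub h3).div_const 2
  simp only [add_zero, sub_zero, zero_div] at h4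
  refine h4.congr' ?_
  filter_upwards [eventually_ge_atTop 1] with n hn
  obtain ⟨n, rfl⟩ : ∃ k, n = k + 1 := ⟨n - 1, by omega⟩
  rw [symmSum_succ_eq, ← add_div, ← sub_div, div_div, mul_comm (returnSeq _ _ _ _)]

theorem IsBoundedSet.ae_symmSum_le {T : X ≃ᵐ X} {M : ℝ} (h : IsBoundedSet T m A M)
    (hT : Ergodic T m) :
    ∀ᵐ x ∂m, ∀ n, symmSum T (ind A) n x ≤ M * (2 * returnSeq T m A n) := by
  filter_upwards [h.bound, (h.symm hT.toMeasurePreserving).bound] with x h1 h2 n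
  cases n with
  | zero => simp [symmSum, returnSeq]
  | succ n =>
    rw [symmSum_succ_eq]
    have h3 := h1 (n + 1)
    have h4 := h2 (n + 1)
    rw [returnSeq_symm hT.toMeasurePreserving h.measurableSet] at h4
    linarith [ind_nonneg A x]

end SymmSum

/-! ### Asymptotic independence of the return sequence from the set. -/

section ReturnSequence

variable {X : Type*} [MeasurableSpace X] {m : Measure X} {A B C D : Set X} {T : X ≃ᵐ X} {M M' : ℝ}

theorem integrable_birkhoffSum_ind (T : X ≃ᵐ X) (hB : MeasurableSet B) [IsFiniteMeasure m] (n : ℕ) :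
    Integrable (birkhoffSum T (ind B) n) m := by
  refine integrable_finsetSum _ fun k _ => ?_
  have h1 : (fun x => ind B (T^[k] x)) = ind (T^[k] ⁻¹' B) := rfl
  rw [h1]
  exact integrable_ind (T.measurable.iterate k hB) (measure_lt_top _ _)

/-- The function 1_C - (m(C)/m(A)) 1_A has integral zero, so its normalized sums tend to 0 almost
everywhere; integrate over `D` by dominated convergence. -/
theorem IsBoundedSet.tendsto_sum_measure_inter_sub (h : IsBoundedSet T m A M) (hT : Ergodic T m)
    (hc : Conservative T m) (hC : MeasurableSet C) (hCA : C ⊆ A) (hD' : m D < ⊤) :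
    Tendsto (fun n => (∑ k ∈ Finset.range n, m.real (D ∩ T^[k] ⁻¹' C) -
      m.real C / m.real A * ∑ k ∈ Finset.range n, m.real (D ∩ T^[k] ⁻¹' A)) / returnSeq T m A n)
      atTop (𝓝 0) := by
  have : IsFiniteMeasure (m.restrict D) := ⟨by simpa using hD'⟩
  have hA := h.measurableSet
  have hCt : m C < ⊤ := (measure_mono hCA).trans_lt h.measure_lt_top
  have hApos := h.real_pos
  obtain ⟨hM, ha⟩ := h.pos_and_tendsto hT hc
  set c := m.real C / m.real A with hcdef
  have hc0 : 0 ≤ c := by positivity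
  have hiC := integrable_ind hC hCt
  have hiA := integrable_ind hA h.measure_lt_top
  have hint : ∫ x, (ind C x - c * ind A x) ∂m = 0 := by
    rw [integral_sub hiC (hiA.const_mul _), integral_const_mul, integral_ind hC, integral_ind hA,
      hcdef]
    field_simp
    ring
  have hS : ∀ n x, birkhoffSum T (fun x => ind C x - c * ind A x) n x =
      birkhoffSum T (ind C) n x - c * birkhoffSum T (ind A) n x := fun n x => by
    simp only [birkhoffSum, Finset.sum_sub_distrib, Finset.mul_sum]
  have hlim := ae_tendsto_birkhoffSum_div hT hiA (by rwa [integral_ind hA]) ha h.bound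
    (hiC.sub (hiA.const_mul c)) hint
  have key : Tendsto (fun n => ∫ x in D, birkhoffSum T (fun x => ind C x - c * ind A x) n x /
      returnSeq T m A n ∂m) atTop (𝓝 (∫ x in D, (0 : ℝ) ∂m)) := by
    refine tendsto_integral_of_dominated_convergence (fun _ => (1 + c) * M) (fun n => ?_)
      (integrable_const _) (fun n => ?_) (ae_restrict_of_ae hlim)
    · exact ((measurable_birkhoffSum T.measurable
        ((measurable_ind hC).sub ((measurable_ind hA).const_mul c)) n).div_const
          _).aestronglyMeasurable
    · refine ae_restrict_of_ae ?_
      filter_upwards [h.bound] with x hx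
      rw [hS, Real.norm_eq_abs, abs_div, abs_of_nonneg (returnSeq_nonneg T m A n)]
      refine div_le_of_le_mul₀ (returnSeq_nonneg T m A n) (by positivity) ?_
      have h1 := birkhoffSum_ind_mono T hCA n x
      have h2 := birkhoffSum_ind_nonneg T C n x
      have h3 := birkhoffSum_ind_nonneg T A n x
      have h4 := hx n
      have h5 := mul_le_mul_of_nonneg_left h4 hc0
      have h6 := mul_nonneg hc0 h3
      rw [abs_le]
      constructor <;> nlinarith
  rw [integral_zero] at key
  refine key.congr fun n => ?_
  simp only [hS]
  rw [integral_div, integral_sub (integrable_birkhoffSum_ind T hC n)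
    ((integrable_birkhoffSum_ind T hA n).const_mul c), integral_const_mul,
    integral_birkhoffSum_ind hD' hC, integral_birkhoffSum_ind hD' hA]

/-- Each copy of `C` is exchanged for `A` at the price of a factor m(C)/m(A): the second copy using
`T` with `D = C`, the first using `T.symm` with `D = A`, after `measure_inter_preimage_iterate`
swaps the roles of the sets. -/
theorem IsBoundedSet.tendsto_returnSeq_div_of_subset (h : IsBoundedSet T m A M) (hT : Ergodic T m)
    (hc : Conservative T m) (hC : MeasurableSet C) (hCA : C ⊆ A) (hC0 : 0 < m C) :
    Tendsto (fun n => returnSeq T m C n / returnSeq T m A n) atTop (𝓝 1) := by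
  have hA := h.measurableSet
  have hmp := hT.toMeasurePreserving
  have hCt : m C < ⊤ := (measure_mono hCA).trans_lt h.measure_lt_top
  have hApos := h.real_pos
  have hCpos : 0 < m.real C := ENNReal.toReal_pos hC0.ne' hCt.ne
  have ha := (h.pos_and_tendsto hT hc).2
  have h1 := h.tendsto_sum_measure_inter_sub hT hc hC hCA hCt
  have h2 := (h.symm hmp).tendsto_sum_measure_inter_sub hT.symm (conservative_symm hmp hc)
    hC hCA h.measure_lt_top
  have hr : returnSeq T.symm m A = returnSeq T m A := funext fun n => returnSeq_symm hmp hA n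
  have hsw : ∀ n, ∑ k ∈ Finset.range n, m.real (A ∩ T.symm^[k] ⁻¹' C) =
      ∑ k ∈ Finset.range n, m.real (C ∩ T^[k] ⁻¹' A) := fun n =>
    Finset.sum_congr rfl fun k _ => by
      rw [Measure.real, ← measure_inter_preimage_iterate hmp hC hA, ← Measure.real]
  have hsA : ∀ n, ∑ k ∈ Finset.range n, m.real (A ∩ T.symm^[k] ⁻¹' A) =
      returnSeq T m A n * m.real A ^ 2 := fun n => by
    rw [sum_measure_inter_eq T.symm h.measure_pos h.measure_lt_top, hr]
  simp only [hr, hsw, hsA] at h2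
  simp only [sum_measure_inter_eq T hC0 hCt] at h1
  have h3 := ((h1.add (h2.const_mul (m.real C / m.real A))).add_const (m.real C ^ 2)).div_const
    (m.real C ^ 2)
  simp only [mul_zero, add_zero, zero_add] at h3
  rw [div_self (by positivity)] at h3
  refine h3.congr' ?_
  filter_upwards [ha.eventually_gt_atTop 0] with n hn
  field_simp
  ring

/-- Some preimage of `B` meets `A` in positive measure, and both return sequences are asymptotic to
that of the intersection. -/
theorem IsBoundedSet.tendsto_returnSeq_div (hA : IsBoundedSet T m A M) (hB : IsBoundedSet T m B M')
    (hT : Ergodic T m) (hc : Conservative T m) :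
    Tendsto (fun n => returnSeq T m A n / returnSeq T m B n) atTop (𝓝 1) := by
  have hmp := hT.toMeasurePreserving
  obtain ⟨k, hk⟩ : ∃ k : ℕ, m (A ∩ T^[k] ⁻¹' B) ≠ 0 := by
    by_contra! hcon
    have h1 : ∀ᵐ x ∂m, ∀ k, x ∉ A ∩ T^[k] ⁻¹' B :=
      ae_all_iff.2 fun k => measure_eq_zero_iff_ae_notMem.1 (hcon k)
    refine hA.measure_pos.ne' (measure_eq_zero_iff_ae_notMem.2 ?_)
    filter_upwards [h1, ae_frequently_mem hT hc hB.measurableSet hB.measure_pos.ne'] with x hx hx' hxA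
    obtain ⟨k, hk⟩ := hx'.exists
    exact hx k ⟨hxA, hk⟩
  obtain ⟨hB', hr⟩ := hB.preimage_iterate hmp k
  have hC : MeasurableSet (A ∩ T^[k] ⁻¹' B) := hA.measurableSet.inter hB'.measurableSet
  have h1 := hA.tendsto_returnSeq_div_of_subset hT hc hC Set.inter_subset_left (pos_iff_ne_zero.2 hk)
  have h2 := hB'.tendsto_returnSeq_div_of_subset hT hc hC Set.inter_subset_right
    (pos_iff_ne_zero.2 hk)
  rw [hr] at h2
  have h3 := h2.div h1 one_ne_zero
  rw [div_one] at h3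
  refine h3.congr' ?_
  filter_upwards [h1.eventually_ne one_ne_zero] with n hn
  have hne : returnSeq T m (A ∩ T^[k] ⁻¹' B) n ≠ 0 := fun h => hn (by simp [h])
  rw [Pi.div_apply, div_div_div_cancel_left' _ _ hne]

end ReturnSequence

/-! ### The limits are constants, and the upper one is at least 1. -/

section Constants

variable {X : Type*} [MeasurableSpace X] {m : Measure X} {A B : Set X} {T : X ≃ᵐ X} {M M' : ℝ}

theorem exists_ae_limsup_eq_const [NeZero m] (hT : Ergodic T m) {u : ℕ → X → ℝ}
    (hu : ∀ n, Measurable (u n)) {K : ℝ} (hK : ∀ᵐ x ∂m, ∀ n, |u n x| ≤ K)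
    (hinv : ∀ᵐ x ∂m, Tendsto (fun n => u n (T x) - u n x) atTop (𝓝 0)) :
    ∃ b : ℝ, ∀ᵐ x ∂m, limsup (fun n => (u n x : EReal)) atTop = b := by
  set F : X → EReal := fun x => limsup (fun n => (u n x : EReal)) atTop with hF
  have hFm : Measurable F := Measurable.limsup fun n => (hu n).coe_real_ereal
  have hFinv : F ∘ T =ᵐ[m] F := by
    filter_upwards [hinv] with x hx
    exact limsup_coe_congr_of_tendsto_sub hx
  obtain ⟨c, hc⟩ := hT.ae_eq_const_of_ae_eq_comp₀ hFm.nullMeasurable hFinv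
  have hc1 : ((-K : ℝ) : EReal) ≤ c ∧ c ≤ ((K : ℝ) : EReal) := by
    obtain ⟨x, hx, hx'⟩ := (hc.and hK).exists
    rw [← (show F x = c from hx)]
    refine ⟨le_limsup_of_frequently_le (Eventually.frequently (Eventually.of_forall fun n => ?_)),
      limsup_le_of_le (h := Eventually.of_forall fun n => ?_)⟩
    · exact EReal.coe_le_coe_iff.2 (abs_le.1 (hx' n)).1
    · exact EReal.coe_le_coe_iff.2 (abs_le.1 (hx' n)).2
  have hc2 : ((c.toReal : ℝ) : EReal) = c := by
    refine EReal.coe_toReal ?_ ?_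
    · rintro rfl; exact absurd hc1.2 (not_le.2 (EReal.coe_lt_top K))
    · rintro rfl; exact absurd hc1.1 (not_le.2 (EReal.bot_lt_coe _))
  refine ⟨c.toReal, ?_⟩
  filter_upwards [hc] with x hx
  rw [hc2]
  exact hx

/-- The two one-sided sums telescope, leaving only the end terms; for an indicator these are
negligible against the return sequence. -/
theorem symmSum_succ_apply_sub (T : X ≃ᵐ X) (f : X → ℝ) (n : ℕ) (x : X) :
    symmSum T f (n + 1) (T x) - symmSum T f (n + 1) x = f (T^[n + 1] x) - f (T.symm^[n] x) := by
  have h1 := birkhoffSum_apply_sub_birkhoffSum T f (n + 1) x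
  have h2 := birkhoffSum_apply_sub_birkhoffSum T.symm f (n + 1) (T x)
  rw [T.symm_apply_apply, Function.iterate_succ_apply, T.symm_apply_apply] at h2
  rw [symmSum_succ_eq, symmSum_succ_eq]
  linarith

theorem IsBoundedSet.tendsto_symmSum_apply_sub (h : IsBoundedSet T m A M) (hT : Ergodic T m)
    (hc : Conservative T m) (x : X) :
    Tendsto (fun n => symmSum T (ind A) n (T x) / (2 * returnSeq T m A n) -
      symmSum T (ind A) n x / (2 * returnSeq T m A n)) atTop (𝓝 0) := by
  have ha := (h.pos_and_tendsto hT hc).2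
  have h0 : Tendsto (fun n => 1 / (2 * returnSeq T m A n)) atTop (𝓝 0) :=
    (ha.const_mul_atTop two_pos).const_div_atTop 1
  refine squeeze_zero_norm' ?_ h0
  filter_upwards [eventually_ge_atTop 1] with n hn
  obtain ⟨n, rfl⟩ : ∃ k, n = k + 1 := ⟨n - 1, by omega⟩
  have h2 : 0 ≤ 2 * returnSeq T m A (n + 1) := mul_nonneg zero_le_two (returnSeq_nonneg _ _ _ _)
  rw [← sub_div, symmSum_succ_apply_sub, Real.norm_eq_abs, abs_div, abs_of_nonneg h2]
  refine div_le_div_of_nonneg_right ?_ h2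
  rw [abs_le]
  constructor <;> linarith [ind_nonneg A (T^[n + 1] x), ind_nonneg A (T.symm^[n] x),
    ind_le_one A (T^[n + 1] x), ind_le_one A (T.symm^[n] x)]

theorem IsBoundedSet.ae_abs_symmSum_div_le (h : IsBoundedSet T m A M) (hT : Ergodic T m)
    (hM : 0 < M) :
    ∀ᵐ x ∂m, ∀ n, |symmSum T (ind A) n x / (2 * returnSeq T m A n)| ≤ M := by
  filter_upwards [h.ae_symmSum_le hT] with x hx n
  have h2 : 0 ≤ 2 * returnSeq T m A n := mul_nonneg zero_le_two (returnSeq_nonneg _ _ _ _)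
  rw [abs_of_nonneg (div_nonneg (symmSum_ind_nonneg _ _ _ _) h2)]
  exact div_le_of_le_mul₀ h2 hM.le (hx n)

theorem IsBoundedSet.neZero (h : IsBoundedSet T m A M) : NeZero m :=
  ⟨by rintro rfl; simpa using h.measure_pos⟩

theorem IsBoundedSet.exists_limsup_liminf (h : IsBoundedSet T m A M) (hT : Ergodic T m)
    (hc : Conservative T m) : ∃ b b' : ℝ, ∀ᵐ x ∂m,
      limsup (fun n => ((symmSum T (ind A) n x / (2 * returnSeq T m A n) : ℝ) : EReal)) atTop = b ∧
      liminf (fun n => ((symmSum T (ind A) n x / (2 * returnSeq T m A n) : ℝ) : EReal)) atTop =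
        b' := by
  have := h.neZero
  have hM := (h.pos_and_tendsto hT hc).1
  have hu : ∀ n, Measurable fun x => symmSum T (ind A) n x / (2 * returnSeq T m A n) := fun n =>
    (measurable_symmSum T (measurable_ind h.measurableSet) n).div_const _
  have hb := h.ae_abs_symmSum_div_le hT hM
  have hi := h.tendsto_symmSum_apply_sub hT hc
  obtain ⟨b, hb1⟩ := exists_ae_limsup_eq_const hT hu hb (ae_of_all _ hi)
  obtain ⟨b', hb2⟩ := exists_ae_limsup_eq_const hT (fun n => (hu n).neg)
    (by simpa only [Pi.neg_apply, abs_neg] using hb) (ae_of_all _ fun x => by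
      have := (hi x).neg
      rw [neg_zero] at this
      refine this.congr fun n => ?_
      simp only [Pi.neg_apply]
      ring)
  refine ⟨b, -b', ?_⟩
  filter_upwards [hb1, hb2] with x h1 h2
  refine ⟨h1, ?_⟩
  rw [liminf_coe_eq_neg_limsup, EReal.coe_neg, ← h2]
  rfl

/-- Reduces every `f` and every witness `B` to the single function 1_A with its own return sequence.
Replacing the denominator costs a factor tending to 1 times a bounded quantity. -/
theorem IsBoundedSet.ae_tendsto_symmSum_sub (hA : IsBoundedSet T m A M) (hB : IsBoundedSet T m B M')
    (hT : Ergodic T m) (hc : Conservative T m) {f : X → ℝ} (hf : Integrable f m) :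
    ∀ᵐ x ∂m, Tendsto (fun n => symmSum T f n x / (2 * returnSeq T m B n) -
      (∫ y, f y ∂m) / m.real A * (symmSum T (ind A) n x / (2 * returnSeq T m A n)))
      atTop (𝓝 0) := by
  obtain ⟨hM, ha⟩ := hA.pos_and_tendsto hT hc
  have hi := integrable_ind hA.measurableSet hA.measure_lt_top
  have hApos := hA.real_pos
  set c := (∫ y, f y ∂m) / m.real A with hcdef
  have h0 : ∫ x, (f x - c * ind A x) ∂m = 0 := by
    rw [integral_sub hf (hi.const_mul _), integral_const_mul, integral_ind hA.measurableSet, hcdef,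
      div_mul_cancel₀ _ hApos.ne', sub_self]
  have hI : Integrable (fun x => f x - c * ind A x) m := hf.sub (hi.const_mul c)
  filter_upwards [hA.ae_tendsto_symmSum_div hT hc hI h0,
    hA.ae_abs_symmSum_div_le hT hM] with x h1 h2
  have h3 := hA.tendsto_returnSeq_div hB hT hc
  have h4 : Tendsto (fun n => returnSeq T m A n / returnSeq T m B n - 1) atTop (𝓝 0) := by
    simpa using h3.sub_const 1
  have h5 : Tendsto (fun n => (returnSeq T m A n / returnSeq T m B n - 1) *
      (c * (symmSum T (ind A) n x / (2 * returnSeq T m A n)))) atTop (𝓝 0) := by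
    refine bdd_le_mul_tendsto_zero' (|c| * M) (Eventually.of_forall fun n => ?_) h4 |>.congr
      fun n => mul_comm _ _
    rw [abs_mul]
    exact mul_le_mul_of_nonneg_left (h2 n) (abs_nonneg c)
  have h6 := (h3.mul h1).add h5
  simp only [mul_zero, add_zero] at h6
  refine h6.congr' ?_
  filter_upwards [ha.eventually_gt_atTop 0] with n hn
  simp only [symmSum_sub_const_mul]
  field_simp
  ring

theorem exists_isUpperBeta_isLowerBeta (hT : Ergodic T m) (hc : Conservative T m)
    (h : BoundedlyRationallyErgodic T m) :
    ∃ β β' : ℝ, IsUpperBeta T m β ∧ IsLowerBeta T m β' := by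
  obtain ⟨A, hA⟩ := h
  obtain ⟨M, hA⟩ := hA.exists_isBoundedSet hT.toMeasurePreserving
  obtain ⟨b, b', hb⟩ := hA.exists_limsup_liminf hT hc
  have hApos := hA.real_pos
  have key : ∀ (β : ℝ) (f : X → ℝ),
      β / m.real A * ∫ y, f y ∂m = β * ((∫ y, f y ∂m) / m.real A) := fun β f => by
    rw [div_mul_eq_mul_div, mul_div_assoc]
  refine ⟨b / m.real A, b' / m.real A, ?_, ?_⟩
  · rintro a ⟨B, hB, rfl⟩ f hf hf0
    obtain ⟨M', hB⟩ := hB.exists_isBoundedSet hT.toMeasurePreserving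
    filter_upwards [hb, hA.ae_tendsto_symmSum_sub hB hT hc hf] with x h1 h2
    rw [key]
    exact limsup_coe_eq_of_tendsto_sub_mul (div_nonneg (integral_nonneg_of_ae hf0) hApos.le) h1.1 h2
  · rintro a ⟨B, hB, rfl⟩ f hf hf0
    obtain ⟨M', hB⟩ := hB.exists_isBoundedSet hT.toMeasurePreserving
    filter_upwards [hb, hA.ae_tendsto_symmSum_sub hB hT hc hf] with x h1 h2
    rw [key]
    exact liminf_coe_eq_of_tendsto_sub_mul (div_nonneg (integral_nonneg_of_ae hf0) hApos.le) h1.2 h2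

/-- Reverse Fatou: the integrals over `A` of the normalized sums tend to m(A)², whereas a limsup
below `d < m(A)` would make their limit at most d·m(A). -/
theorem IsBoundedSet.measure_le_of_limsup (h : IsBoundedSet T m A M) (hT : Ergodic T m)
    (hc : Conservative T m) {b : ℝ} (hb : ∀ᵐ x ∂m,
      limsup (fun n => ((symmSum T (ind A) n x / (2 * returnSeq T m A n) : ℝ) : EReal)) atTop = b) :
    m.real A ≤ b := by
  by_contra! hlt
  obtain ⟨d, hbd, hdA⟩ := exists_between hlt
  have hA := h.measurableSet
  have hApos := h.real_pos
  obtain ⟨hM, ha⟩ := h.pos_and_tendsto hT hc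
  have hfin : IsFiniteMeasure (m.restrict A) := ⟨by simpa using h.measure_lt_top⟩
  set u : ℕ → X → ℝ := fun n x => symmSum T (ind A) n x / (2 * returnSeq T m A n) with hu
  have hum : ∀ n, Measurable (u n) := fun n => (measurable_symmSum T (measurable_ind hA) n).div_const _
  have hub := h.ae_abs_symmSum_div_le hT hM
  have hui : ∀ n, Integrable (u n) (m.restrict A) := fun n =>
    Integrable.of_bound (hum n).aestronglyMeasurable M
      (ae_restrict_of_ae (hub.mono fun x hx => hx n))
  have h1 : Tendsto (fun n => ∫ x in A, max (u n x) d ∂m) atTop (𝓝 (∫ _ in A, d ∂m)) := by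
    refine tendsto_integral_of_dominated_convergence (fun _ => M + |d|) (fun n => ?_)
      (integrable_const _) (fun n => ?_) ?_
    · exact ((hum n).max measurable_const).aestronglyMeasurable
    · refine ae_restrict_of_ae (hub.mono fun x hx => ?_)
      have hx := hx n
      rw [Real.norm_eq_abs]
      refine (abs_max_le_max_abs_abs).trans (max_le ?_ ?_)
      · linarith [abs_nonneg d]
      · linarith
    · refine ae_restrict_of_ae (hb.mono fun x hx => ?_)
      refine tendsto_const_nhds.congr' ?_
      have : limsup (fun n => (u n x : EReal)) atTop < d := by
        rw [hx]; exact_mod_cast hbd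
      filter_upwards [eventually_lt_of_limsup_lt this] with n hn
      rw [max_eq_right]
      exact_mod_cast hn.le
  have h2 : Tendsto (fun n => ∫ x in A, u n x ∂m) atTop (𝓝 (m.real A ^ 2)) := by
    -- The subtracted term corrects the double count of time 0; it vanishes in the limit.
    have h3 : Tendsto (fun n => m.real A ^ 2 - m.real A / (2 * returnSeq T m A n)) atTop
        (𝓝 (m.real A ^ 2 - 0)) :=
      tendsto_const_nhds.sub ((ha.const_mul_atTop two_pos).const_div_atTop _)
    rw [sub_zero] at h3
    refine h3.congr' ?_
    filter_upwards [eventually_ge_atTop 1, ha.eventually_gt_atTop 0] with n hn hn0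
    obtain ⟨n, rfl⟩ : ∃ k, n = k + 1 := ⟨n - 1, by omega⟩
    simp only [hu]
    rw [integral_div]
    simp only [symmSum_succ_eq]
    have hI : Integrable (ind A) (m.restrict A) :=
      integrable_ind hA (MeasureTheory.measure_lt_top _ _)
    have hI1 := integrable_birkhoffSum_ind (m := m.restrict A) T hA (n + 1)
    have hI2 := integrable_birkhoffSum_ind (m := m.restrict A) T.symm hA (n + 1)
    have hI3 : Integrable (fun x => birkhoffSum T (ind A) (n + 1) x +
      birkhoffSum T.symm (ind A) (n + 1) x) (m.restrict A) := hI1.add hI2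
    rw [integral_sub hI3 hI, integral_add hI1 hI2, integral_ind hA,
      integral_birkhoffSum_ind h.measure_lt_top hA, integral_birkhoffSum_ind h.measure_lt_top hA,
      sum_measure_inter_eq T h.measure_pos h.measure_lt_top,
      sum_measure_inter_eq T.symm h.measure_pos h.measure_lt_top,
      returnSeq_symm hT.toMeasurePreserving hA]
    have : (m.restrict A).real A = m.real A := by simp [Measure.real]
    rw [this]
    field_simp
    ring
  have h3 := le_of_tendsto_of_tendsto' h2 h1 fun n =>
    integral_mono (hui n) ((hui n).sup (integrable_const d)) fun x => le_max_left _ _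
  rw [integral_const, smul_eq_mul] at h3
  have : (m.restrict A).real Set.univ = m.real A := by simp [Measure.real]
  rw [this] at h3
  nlinarith

end Constants

/-! ### Gaps between returns and the renewal argument. -/

section Gaps

variable {X : Type*} [MeasurableSpace X] {m : Measure X} {A H : Set X} {T : X ≃ᵐ X} {M : ℝ}

/-- The points of `H` none of whose first `k` preimages lies in `H`. -/
def gapSet (T : X ≃ᵐ X) (H : Set X) (k : ℕ) : Set X :=
  {y | y ∈ H ∧ ∀ j, 1 ≤ j → j ≤ k → T.symm^[j] y ∉ H}

theorem gapSet_subset (T : X ≃ᵐ X) (H : Set X) (k : ℕ) : gapSet T H k ⊆ H := fun _ h => h.1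

theorem antitone_gapSet (T : X ≃ᵐ X) (H : Set X) : Antitone (gapSet T H) :=
  fun _ _ hkl _ h => ⟨h.1, fun j h1 h2 => h.2 j h1 (h2.trans hkl)⟩

theorem measurableSet_gapSet (T : X ≃ᵐ X) (hH : MeasurableSet H) (k : ℕ) :
    MeasurableSet (gapSet T H k) := by
  have : gapSet T H k = H ∩ ⋂ j, ⋂ (_ : 1 ≤ j), ⋂ (_ : j ≤ k), (T.symm^[j] ⁻¹' H)ᶜ := by
    ext x; simp [gapSet]
  rw [this]
  exact hH.inter (MeasurableSet.iInter fun j => MeasurableSet.iInter fun _ =>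
    MeasurableSet.iInter fun _ => (T.symm.measurable.iterate j hH).compl)

theorem symm_iterate_iterate_of_le (T : X ≃ᵐ X) {j k : ℕ} (h : j ≤ k) (x : X) :
    T.symm^[j] (T^[k] x) = T^[k - j] x := by
  conv_lhs => rw [← Nat.add_sub_of_le h, Function.iterate_add_apply, symm_iterate_iterate]

/-- These preimages are the level sets of the first entry time to `H`, time 0 included; hence they
are disjoint and, under recurrence, cover almost all of X. -/
theorem mem_preimage_gapSet {k : ℕ} {x : X} :
    x ∈ T^[k] ⁻¹' gapSet T H k ↔ T^[k] x ∈ H ∧ ∀ j < k, T^[j] x ∉ H := by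
  simp only [Set.mem_preimage, gapSet, Set.mem_ofPred_eq]
  refine and_congr_right fun _ => ⟨fun h j hj => ?_, fun h j h1 h2 => ?_⟩
  · have := h (k - j) (by omega) (by omega)
    rwa [symm_iterate_iterate_of_le T (by omega), Nat.sub_sub_self hj.le] at this
  · rw [symm_iterate_iterate_of_le T h2]
    exact h _ (by omega)

theorem exists_mem_preimage_gapSet {n : ℕ} {x : X} (h : T^[n] x ∈ H) :
    ∃ k ≤ n, x ∈ T^[k] ⁻¹' gapSet T H k := by
  classical
  have hex : ∃ k, T^[k] x ∈ H := ⟨n, h⟩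
  exact ⟨Nat.find hex, Nat.find_min' hex h,
    mem_preimage_gapSet.2 ⟨Nat.find_spec hex, fun j hj => Nat.find_min hex hj⟩⟩

theorem pairwise_disjoint_preimage_gapSet (T : X ≃ᵐ X) (H : Set X) :
    Pairwise (Function.onFun Disjoint fun k => T^[k] ⁻¹' gapSet T H k) := by
  intro k l hkl
  rw [Function.onFun, Set.disjoint_left]
  intro x hk hl
  rw [mem_preimage_gapSet] at hk hl
  rcases lt_or_gt_of_ne hkl with h | h
  · exact hl.2 k h hk.1
  · exact hk.2 l h hl.1

theorem measure_preimage_iterate (hT : MeasurePreserving T m m) {s : Set X} (hs : MeasurableSet s)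
    (k : ℕ) : m (T^[k] ⁻¹' s) = m s :=
  (hT.iterate k).measure_preimage hs.nullMeasurableSet

/-- A renewal inequality: `N m(H) ≤ M a_N(A) ∑_{k<N} m(gapSet k)`. -/
theorem IsBoundedSet.mul_measure_le (h : IsBoundedSet T m A M) (hT : MeasurePreserving T m m)
    (hH : MeasurableSet H) (hHA : H ⊆ A) (N : ℕ) :
    N * m.real H ≤ M * returnSeq T m A N * ∑ k ∈ Finset.range N, m.real (gapSet T H k) := by
  have hHt : m H < ⊤ := (measure_mono hHA).trans_lt h.measure_lt_top
  have hR := measurableSet_gapSet T hH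
  have hRt : ∀ k, m (gapSet T H k) < ⊤ := fun k => (measure_mono (gapSet_subset T H k)).trans_lt hHt
  -- Decomposition of T^{-n}H by the first entry time k, followed by invariance under T^k.
  have h1 : ∀ n, m.real H ≤
      ∑ k ∈ Finset.range (n + 1), m.real (gapSet T H k ∩ T^[n - k] ⁻¹' H) := by
    intro n
    have h2 : m.real (T^[n] ⁻¹' H) = m.real H := by
      simp only [Measure.real, measure_preimage_iterate hT hH]
    have h3 : ∀ k ∈ Finset.range (n + 1), m.real (T^[k] ⁻¹' (gapSet T H k ∩ T^[n - k] ⁻¹' H)) =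
        m.real (gapSet T H k ∩ T^[n - k] ⁻¹' H) := fun k _ => by
      simp only [Measure.real, measure_preimage_iterate hT
        ((hR k).inter (T.measurable.iterate (n - k) hH))]
    rw [← h2, ← Finset.sum_congr rfl h3]
    refine le_trans (measureReal_mono ?_ ?_) (measureReal_biUnion_finset_le _ _)
    · intro x hx
      obtain ⟨k, hk, hkx⟩ := exists_mem_preimage_gapSet hx
      simp only [Set.mem_iUnion, Finset.mem_range]
      refine ⟨k, by omega, hkx, ?_⟩
      rw [Set.mem_preimage, ← Function.iterate_add_apply, Nat.sub_add_cancel hk]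
      exact hx
    · refine (measure_biUnion_lt_top (Finset.finite_toSet _) fun k _ => ?_).ne
      rw [measure_preimage_iterate hT ((hR k).inter (T.measurable.iterate (n - k) hH))]
      exact (measure_mono Set.inter_subset_left).trans_lt (hRt k)
  have h4 : N * m.real H ≤ ∑ n ∈ Finset.range N,
      ∑ k ∈ Finset.range (n + 1), m.real (gapSet T H k ∩ T^[n - k] ⁻¹' H) := by
    have := Finset.sum_le_sum (s := Finset.range N) fun n _ => h1 n
    simpa using this
  have h5 : ∑ n ∈ Finset.range N,
      ∑ k ∈ Finset.range (n + 1), m.real (gapSet T H k ∩ T^[n - k] ⁻¹' H) =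
      ∑ k ∈ Finset.range N, ∑ n ∈ Finset.Ico k N, m.real (gapSet T H k ∩ T^[n - k] ⁻¹' H) :=
    Finset.sum_comm' fun n k => by simp only [Finset.mem_range, Finset.mem_Ico]; omega
  refine (h4.trans h5.le).trans ?_
  rw [Finset.mul_sum]
  refine Finset.sum_le_sum fun k _ => ?_
  -- After entry at time k only N - k steps remain; extending to N makes the bound uniform in k.
  have h6 : ∑ n ∈ Finset.Ico k N, m.real (gapSet T H k ∩ T^[n - k] ⁻¹' H) ≤
      ∑ i ∈ Finset.range N, m.real (gapSet T H k ∩ T^[i] ⁻¹' H) := by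
    rw [Finset.sum_Ico_eq_sum_range]
    simp only [Nat.add_sub_cancel_left]
    exact Finset.sum_le_sum_of_subset_of_nonneg (Finset.range_mono (Nat.sub_le N k))
      fun _ _ _ => measureReal_nonneg
  refine h6.trans ?_
  have : IsFiniteMeasure (m.restrict (gapSet T H k)) := ⟨by simpa using hRt k⟩
  rw [← integral_birkhoffSum_ind (hRt k) hH]
  have h7 : ∫ x in gapSet T H k, birkhoffSum T (ind H) N x ∂m ≤
      ∫ _ in gapSet T H k, M * returnSeq T m A N ∂m := by
    refine integral_mono_ae (integrable_birkhoffSum_ind T hH N) (integrable_const _)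
      (ae_restrict_of_ae ?_)
    filter_upwards [h.bound] with x hx
    exact (birkhoffSum_ind_mono T hHA N x).trans (hx N)
  refine h7.trans_eq ?_
  rw [integral_const, smul_eq_mul, mul_comm]
  simp [Measure.real]

/-- A finite sum would give X finite measure, since the first-entry level sets cover it. This is
where infinite measure enters. -/
theorem tendsto_sum_measure_gapSet (hT : Ergodic T m) (hc : Conservative T m)
    (hinf : m Set.univ = ⊤) (hH : MeasurableSet H) (h0 : m H ≠ 0) (ht : m H < ⊤) :
    Tendsto (fun N => ∑ k ∈ Finset.range N, m.real (gapSet T H k)) atTop atTop := by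
  rw [← not_summable_iff_tendsto_nat_atTop_of_nonneg fun _ => measureReal_nonneg]
  intro hs
  have hRt : ∀ k, m (gapSet T H k) ≠ ⊤ := fun k =>
    ((measure_mono (gapSet_subset T H k)).trans_lt ht).ne
  have h1 : ∑' k, m (gapSet T H k) = ⊤ := by
    rw [← top_le_iff, ← hinf]
    have h2 : m Set.univ ≤ m (⋃ k, T^[k] ⁻¹' gapSet T H k) := by
      refine measure_mono_ae ?_
      filter_upwards [ae_frequently_mem hT hc hH h0] with x hx _
      obtain ⟨n, hn⟩ := hx.exists
      obtain ⟨k, -, hk⟩ := exists_mem_preimage_gapSet hn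
      exact Set.mem_iUnion.2 ⟨k, hk⟩
    refine h2.trans ((measure_iUnion_le _).trans_eq ?_)
    exact tsum_congr fun k =>
      measure_preimage_iterate hT.toMeasurePreserving (measurableSet_gapSet T hH k) k
  have h2 := hs.tsum_ofReal_ne_top
  refine h2 ?_
  rw [← h1]
  exact tsum_congr fun k => ENNReal.ofReal_toReal (hRt k)

theorem tendsto_measure_gapSet (hT : MeasurePreserving T m m) (hc : Conservative T m)
    (hH : MeasurableSet H) (ht : m H < ⊤) :
    Tendsto (fun k => m (gapSet T H k)) atTop (𝓝 0) := by
  have h0 : m (⋂ k, gapSet T H k) = 0 := by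
    refine measure_eq_zero_iff_ae_notMem.2 ?_
    filter_upwards [(conservative_symm hT hc).ae_mem_imp_frequently_image_mem hH.nullMeasurableSet]
      with x hx hx'
    rw [Set.mem_iInter] at hx'
    obtain ⟨n, hn, hnH⟩ := frequently_atTop.1 (hx (hx' 0).1) 1
    exact (hx' n).2 n hn le_rfl hnH
  rw [← h0]
  exact tendsto_measure_iInter_atTop (fun k => (measurableSet_gapSet T hH k).nullMeasurableSet)
    (antitone_gapSet T H) ⟨0, ((measure_mono (gapSet_subset T H 0)).trans_lt ht).ne⟩

/-- The number of visits to `A` between a point of `H` and its last previous visit to `H`. -/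
noncomputable def gapCount (T : X ≃ᵐ X) (A H : Set X) (y : X) : ENNReal :=
  ∑' j : ℕ, (gapSet T H (j + 1) ∩ T.symm^[j + 1] ⁻¹' A).indicator (fun _ => 1) y

/-- As in Kac's formula: pulled back by T^{j+1}, the summands become indicators of disjoint subsets
of `A`. -/
theorem lintegral_gapCount_le (hT : MeasurePreserving T m m) (hA : MeasurableSet A)
    (hH : MeasurableSet H) : ∫⁻ y, gapCount T A H y ∂m ≤ m A := by
  have hR := measurableSet_gapSet T hH
  have hm : ∀ j : ℕ, MeasurableSet (gapSet T H (j + 1) ∩ T.symm^[j + 1] ⁻¹' A) := fun j =>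
    (hR (j + 1)).inter (T.symm.measurable.iterate (j + 1) hA)
  simp only [gapCount]
  rw [lintegral_tsum fun j => (measurable_const.indicator (hm j)).aemeasurable]
  have h1 : ∀ j : ℕ, ∫⁻ y, (gapSet T H (j + 1) ∩ T.symm^[j + 1] ⁻¹' A).indicator (fun _ => 1) y ∂m =
      m (T^[j + 1] ⁻¹' gapSet T H (j + 1) ∩ A) := fun j => by
    rw [lintegral_indicator (hm j), setLIntegral_one, ← measure_preimage_iterate hT (hm j) (j + 1)]
    congr 1
    ext x
    simp only [Set.mem_preimage, Set.mem_inter_iff, symm_iterate_iterate]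
  simp only [h1]
  have hdis : Pairwise (Function.onFun Disjoint
      fun j : ℕ => T^[j + 1] ⁻¹' gapSet T H (j + 1) ∩ A) := fun j k hjk =>
    (pairwise_disjoint_preimage_gapSet T H (show j + 1 ≠ k + 1 by omega)).mono
      Set.inter_subset_left Set.inter_subset_left
  rw [← measure_iUnion hdis fun j => (T.measurable.iterate (j + 1) (hR (j + 1))).inter hA]
  exact measure_mono (Set.iUnion_subset fun j => Set.inter_subset_right)

theorem ofReal_sum_le_gapCount {k : ℕ} {y : X} (hy : y ∈ gapSet T H k) :
    ENNReal.ofReal (∑ j ∈ Finset.range k, ind A (T.symm^[j + 1] y)) ≤ gapCount T A H y := by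
  rw [ENNReal.ofReal_sum_of_nonneg fun _ _ => ind_nonneg _ _]
  refine le_trans (Finset.sum_le_sum fun j hj => ?_) (ENNReal.sum_le_tsum (Finset.range k))
  have hj' : y ∈ gapSet T H (j + 1) := antitone_gapSet T H (Finset.mem_range.1 hj) hy
  by_cases hA : T.symm^[j + 1] y ∈ A
  · have hm : y ∈ gapSet T H (j + 1) ∩ T.symm^[j + 1] ⁻¹' A := ⟨hj', hA⟩
    rw [ind_of_mem hA, Set.indicator_of_mem hm, ENNReal.ofReal_one]
  · rw [ind_of_notMem hA, ENNReal.ofReal_zero]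
    exact zero_le

/-- There are arbitrarily long gaps between visits to `H` which contain few visits to `A`,
relative to the return sequence at the length of the gap. -/
theorem IsBoundedSet.exists_sparse_gap (h : IsBoundedSet T m A M) (hT : Ergodic T m)
    (hc : Conservative T m) (hinf : m Set.univ = ⊤) (hH : MeasurableSet H) (hHA : H ⊆ A)
    (h0 : m H ≠ 0) {C : ℝ} (hC : 0 < C) (K : ℕ) :
    ∃ k ≥ K, ∃ y ∈ H,
      C * ∑ j ∈ Finset.range k, ind A (T.symm^[j + 1] y) < returnSeq T m A (k + 1) := by
  by_contra! hcon
  have hmp := hT.toMeasurePreserving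
  have hM := (h.pos_and_tendsto hT hc).1
  have hHt : m H < ⊤ := (measure_mono hHA).trans_lt h.measure_lt_top
  have hHpos : 0 < m.real H := ENNReal.toReal_pos h0 hHt.ne
  have hR := measurableSet_gapSet T hH
  have hRt : ∀ k, m (gapSet T H k) < ⊤ := fun k => (measure_mono (gapSet_subset T H k)).trans_lt hHt
  set Q : ℕ → ℝ := fun N => ∑ k ∈ Finset.range N, m.real (gapSet T H k) with hQ
  have hQtop : Tendsto Q atTop atTop := tendsto_sum_measure_gapSet hT hc hinf hH h0 hHt
  have hQmono : Monotone Q := monotone_nat_of_le_succ fun N => by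
    simp only [hQ, Finset.sum_range_succ]
    linarith [measureReal_nonneg (μ := m) (s := gapSet T H N)]
  have hQnn : ∀ N, 0 ≤ Q N := fun N => Finset.sum_nonneg fun _ _ => measureReal_nonneg
  -- Chosen so that the renewal inequality and the negated claim bound truncated gap lengths by `D *
  -- Q N` times the visit count.
  set D : ℝ := M * C / m.real H with hD
  have hDpos : 0 < D := by positivity
  have hγ : Tendsto (fun k => ∫⁻ y in gapSet T H k, gapCount T A H y ∂m) atTop (𝓝 0) :=
    tendsto_setLIntegral_zero ((lintegral_gapCount_le hmp h.measurableSet hH).trans_lt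
      h.measure_lt_top).ne (tendsto_measure_gapSet hmp hc hH hHt)
  -- Integrability of `gapCount` makes its integral over long gaps at most 1/(2D), so that half of
  -- `Q N` can be absorbed below.
  obtain ⟨L, hLK, hL⟩ : ∃ L ≥ K, ∫⁻ y in gapSet T H L, gapCount T A H y ∂m ≤
      ENNReal.ofReal (1 / (2 * D)) := by
    have := (ENNReal.tendsto_nhds_zero.1 hγ (ENNReal.ofReal (1 / (2 * D)))
      (by rw [gt_iff_lt, ENNReal.ofReal_pos]; positivity))
    obtain ⟨L, h1, h2⟩ := (this.and (eventually_ge_atTop K)).exists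
    exact ⟨L, h2, h1⟩
  have hfin : ∀ᵐ y ∂m, y ∈ gapSet T H L → ∃ k ≥ L, y ∈ gapSet T H k ∧ y ∉ gapSet T H (k + 1) := by
    filter_upwards [(conservative_symm hmp hc).ae_mem_imp_frequently_image_mem hH.nullMeasurableSet]
      with y hy hyL
    by_contra! hcon'
    have hall : ∀ k, y ∈ gapSet T H (L + k) := fun k => by
      induction k with
      | zero => exact hyL
      | succ k ih => exact hcon' (L + k) (by omega) ih
    obtain ⟨n, hn, hnH⟩ := frequently_atTop.1 (hy hyL.1) 1
    exact (hall n).2 n hn (by omega) hnH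
  -- If `k` is the last index with `y` in the gap set, the left side is at most `min N (k + 1)`, to
  -- which the renewal inequality is applied.
  have hpt : ∀ N, ∀ᵐ y ∂m, y ∈ gapSet T H L →
      ∑ j ∈ Finset.range N, (gapSet T H j).indicator (fun _ => (1 : ENNReal)) y ≤
        ENNReal.ofReal (D * Q N) * gapCount T A H y := by
    intro N
    filter_upwards [hfin] with y hy hyL
    obtain ⟨k, hkL, hk, hk'⟩ := hy hyL
    set n := min N (k + 1) with hn
    have h1 : ∑ j ∈ Finset.range N, (gapSet T H j).indicator (fun _ => (1 : ENNReal)) y ≤ n := by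
      rw [← Finset.sum_subset (Finset.range_mono (min_le_left N (k + 1)))]
      · refine (Finset.sum_le_sum fun j _ => Set.indicator_le_self' (fun _ _ => zero_le) y).trans ?_
        simp [hn]
      · intro j hj hj'
        refine Set.indicator_of_notMem (fun hjR => hk' (antitone_gapSet T H ?_ hjR)) _
        simp only [Finset.mem_range, lt_min_iff, not_and, not_lt] at hj hj'
        exact hj' hj
    have h2 := h.mul_measure_le hmp hH hHA n
    have h3 := hcon k (hLK.le.trans hkL) y hk.1
    set s := ∑ j ∈ Finset.range k, ind A (T.symm^[j + 1] y) with hs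
    have h4 : (n : ℝ) ≤ D * Q N * s := by
      have h5 : returnSeq T m A n ≤ C * s :=
        (monotone_returnSeq T m A (min_le_right N (k + 1))).trans h3
      have h6 : Q n ≤ Q N := hQmono (min_le_left N (k + 1))
      have h7 : (n : ℝ) * m.real H ≤ M * (C * s) * Q N := by
        refine h2.trans ?_
        refine mul_le_mul (mul_le_mul_of_nonneg_left h5 hM.le) h6 (hQnn n) ?_
        exact mul_nonneg hM.le ((returnSeq_nonneg _ _ _ _).trans h5)
      rw [hD, div_mul_eq_mul_div, div_mul_eq_mul_div, le_div_iff₀ hHpos]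
      linarith
    refine h1.trans ?_
    have h5 : (n : ENNReal) = ENNReal.ofReal n := by simp
    rw [h5]
    refine (ENNReal.ofReal_le_ofReal h4).trans ?_
    rw [ENNReal.ofReal_mul (mul_nonneg hDpos.le (hQnn N))]
    gcongr
    exact ofReal_sum_le_gapCount hk
  -- Integrating the pointwise bound over `gapSet T H L` gives `Q N - Q L ≤ Q N / 2`, so `Q` would
  -- be bounded.
  have hbd : ∀ N, Q N ≤ 2 * Q L := by
    intro N
    rcases le_total N L with hNL | hLN
    · linarith [hQmono hNL, hQnn L]
    have h1 : ∫⁻ y in gapSet T H L,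
        ∑ j ∈ Finset.range N, (gapSet T H j).indicator (fun _ => (1 : ENNReal)) y ∂m ≤
        ENNReal.ofReal (Q N / 2) := by
      calc _ ≤ ∫⁻ y in gapSet T H L, ENNReal.ofReal (D * Q N) * gapCount T A H y ∂m :=
            lintegral_mono_ae ((ae_restrict_iff' (hR L)).2 (hpt N))
        _ = ENNReal.ofReal (D * Q N) * ∫⁻ y in gapSet T H L, gapCount T A H y ∂m :=
            lintegral_const_mul' _ _ ENNReal.ofReal_ne_top
        _ ≤ ENNReal.ofReal (D * Q N) * ENNReal.ofReal (1 / (2 * D)) := by gcongr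
        _ = ENNReal.ofReal (Q N / 2) := by
            rw [← ENNReal.ofReal_mul (mul_nonneg hDpos.le (hQnn N))]
            congr 1
            field_simp
    have h2 : ENNReal.ofReal (Q N - Q L) ≤ ∫⁻ y in gapSet T H L,
        ∑ j ∈ Finset.range N, (gapSet T H j).indicator (fun _ => (1 : ENNReal)) y ∂m := by
      rw [lintegral_finsetSum _ fun j _ => measurable_const.indicator (hR j)]
      have h3 : Q N - Q L = ∑ j ∈ Finset.Ico L N, m.real (gapSet T H j) := by
        rw [Finset.sum_Ico_eq_sub _ hLN]
      rw [h3, ENNReal.ofReal_sum_of_nonneg fun _ _ => measureReal_nonneg]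
      refine le_trans (Finset.sum_le_sum fun j hj => ?_)
        (Finset.sum_le_sum_of_subset (s := Finset.Ico L N) fun j hj => ?_)
      · rw [lintegral_indicator (hR j), setLIntegral_one, Measure.restrict_apply (hR j),
          Set.inter_eq_left.2 (antitone_gapSet T H (Finset.mem_Ico.1 hj).1)]
        exact (ENNReal.ofReal_toReal (hRt j).ne).le
      · exact Finset.mem_range.2 (Finset.mem_Ico.1 hj).2
    have h3 := (ENNReal.ofReal_le_ofReal_iff (by linarith [hQnn N])).1 (h2.trans h1)
    linarith
  obtain ⟨N, hN⟩ := (hQtop.eventually_gt_atTop (2 * Q L)).exists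
  exact absurd (hbd N) (not_le.2 hN)

end Gaps

/-! ### The combinatorial contradiction. -/

section Counting

/-- Among the first `n` integers there is a good one such that, up to the number of bad points,
no points are counted after it. -/
theorem exists_good_of_lt {F D : ℕ → ℝ} {g : ℕ → Prop} (hF0 : F 0 = 0) (hD0 : D 0 = 0)
    (hstep : ∀ n, F (n + 1) ≤ F n + 1) (hD : Monotone D)
    (hgood : ∀ n, g n ∨ F (n + 1) - F n ≤ D (n + 1) - D n) (n : ℕ) (h : D n < F n) :
    ∃ s < n, g s ∧ F n ≤ F s + 1 + D n := by
  induction n with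
  | zero => linarith
  | succ n ih =>
    rcases hgood n with hg | hb
    · exact ⟨n, n.lt_succ_self, hg, by
        linarith [hstep n, hD (Nat.zero_le (n + 1))]⟩
    · obtain ⟨s, hs, hgs, hle⟩ := ih (by linarith)
      exact ⟨s, hs.trans n.lt_succ_self, hgs, by linarith⟩

/-- A counting function `F` starting after a sparse gap cannot have symmetric windows which are
uniformly well approximated by `b` around all good points. -/
theorem false_of_window_counts {F D b : ℕ → ℝ} {g : ℕ → Prop} {N ℓ : ℕ} (hN : 1 ≤ N)
    (hF0 : F 0 = 0) (hD0 : D 0 = 0) (hF : Monotone F)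
    (hstep : ∀ n, F (n + 1) ≤ F n + 1) (hD : Monotone D)
    (hgood : ∀ n, g n ∨ F (n + 1) - F n ≤ D (n + 1) - D n) (hb : Monotone b)
    (hwin : ∀ s, g s → ∀ n, N ≤ n → n ≤ s →
      99 / 100 * b n ≤ F (s + n) - F (s - n + 1) ∧ F (s + n) - F (s - n + 1) ≤ b n)
    (hup : ∀ n, N ≤ n → F n ≤ b n)
    (hlow : ∀ n, N ≤ n → n ≤ ℓ → 99 / 100 * b n - b ℓ / 100 ≤ F n)
    (hDℓ : D ℓ ≤ b ℓ / 100) (hNℓ : N ≤ ℓ) (hbℓ : 100 * (N + 1 : ℝ) ≤ b ℓ) : False := by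
  have hFn : ∀ n : ℕ, F n ≤ n := fun n => by
    induction n with
    | zero => simp [hF0]
    | succ n ih => push_cast; linarith [hstep n]
  have hN1 : (1 : ℝ) ≤ N := by exact_mod_cast hN
  have hFℓ := hlow ℓ hNℓ le_rfl
  have h1 : F 1 ≤ 1 := by simpa [hF0] using hstep 0
  -- `F ℓ` is at least 0.98 `b ℓ` and bad points account for at most 0.01 `b ℓ`, so `F s` is at
  -- least 0.97 `b ℓ - 1`.
  obtain ⟨s, hsℓ, hgs, hs⟩ := exists_good_of_lt hF0 hD0 hstep hD hgood ℓ (by linarith)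
  obtain ⟨t, htℓ, ht1, ht2⟩ : ∃ t ≤ ℓ, F t ≤ 3 / 5 * b ℓ ∧ 3 / 5 * b ℓ < F t + 1 := by
    classical
    have hex : ∃ t, 3 / 5 * b ℓ < F t := ⟨ℓ, by linarith⟩
    have hspec := Nat.find_spec hex
    have hle : Nat.find hex ≤ ℓ := Nat.find_min' hex (by linarith)
    have hne : Nat.find hex ≠ 0 := fun h0 => by
      rw [h0, hF0] at hspec
      linarith
    obtain ⟨t, ht⟩ := Nat.exists_eq_succ_of_ne_zero hne
    refine ⟨t, by omega, not_lt.1 (Nat.find_min hex (by omega)), ?_⟩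
    rw [ht] at hspec
    exact hspec.trans_le (hstep t)
  have hDt : D t ≤ b ℓ / 100 := (hD htℓ).trans hDℓ
  -- Here `F r` lies between 0.59 `b ℓ - 2` and 0.6 `b ℓ`.
  obtain ⟨r, hrt, hgr, hr⟩ := exists_good_of_lt hF0 hD0 hstep hD hgood t (by linarith)
  have hFr : F r ≤ F t := hF hrt.le
  have hNr : N ≤ r := by
    have h2 := hFn r
    have : (N : ℝ) ≤ r := by linarith
    exact_mod_cast this
  have hrlow := hlow r hNr (hrt.le.trans htℓ)
  have hr2 := (hwin r hgr r hNr le_rfl).2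
  rw [Nat.sub_self, zero_add] at hr2
  -- `hrlow` gives `b r` at most about 0.62 `b ℓ`, and the window of radius `r` around `r` bounds `F
  -- (r + r)` by `b r + 1`, which is less than `F s`.
  have hrs : r + r < s := by
    by_contra! hcon
    linarith [hF hcon]
  have hs2 := (hwin s hgs s (by omega) le_rfl).2
  rw [Nat.sub_self, zero_add] at hs2
  have hbs := hb hsℓ.le
  -- This window can hold at most about 0.41 `b ℓ`, yet `r ≤ s - r` forces at least 0.99 `b r`,
  -- about 0.58 `b ℓ`.
  have hw := (hwin s hgs (s - r) (by omega) (Nat.sub_le s r)).1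
  have h3 : F (s + (s - r)) ≤ F (s + s) := hF (by omega)
  have h4 : F r ≤ F (s - (s - r) + 1) := hF (by omega)
  have h5 : b r ≤ b (s - r) := hb (by omega)
  linarith [hup r hNr]

end Counting

/-! ### Derivation of the lower bound 1/5000. -/

section Gap

variable {X : Type*} [MeasurableSpace X] {m : Measure X} {A G : Set X} {T : X ≃ᵐ X} {M : ℝ}

theorem symmSum_succ_eq_add_sum (T : X ≃ᵐ X) (f : X → ℝ) (n : ℕ) (x : X) :
    symmSum T f (n + 1) x =
      birkhoffSum T f (n + 1) x + ∑ j ∈ Finset.range n, f (T.symm^[j + 1] x) := by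
  rw [symmSum_succ_eq, birkhoffSum_succ' T.symm]
  have : birkhoffSum T.symm f n (T.symm x) = ∑ j ∈ Finset.range n, f (T.symm^[j + 1] x) := rfl
  rw [this]
  ring

/-- Since `n ≤ s`, the window around time `s` covers the times from `s - n + 1` to `s + n - 1`, all
in the forward orbit of `x`. -/
theorem symmSum_iterate_eq (T : X ≃ᵐ X) (f : X → ℝ) {n s : ℕ} (hn : 1 ≤ n) (hns : n ≤ s) (x : X) :
    symmSum T f n (T^[s] x) = birkhoffSum T f (s + n) x - birkhoffSum T f (s - n + 1) x := by
  obtain ⟨n, rfl⟩ : ∃ k, n = k + 1 := ⟨n - 1, by omega⟩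
  have h1 := birkhoffSum_add T f s (n + 1) x
  have h2 := birkhoffSum_add T f (s - n) (n + 1) x
  have h3 := birkhoffSum_succ T f s x
  rw [show s - n + (n + 1) = s + 1 by omega] at h2
  rw [symmSum_succ_eq, birkhoffSum_symm_eq, symm_iterate_iterate_of_le T (by omega), h1,
    show s - (n + 1) + 1 = s - n by omega]
  linarith

/-- Instance of `false_of_window_counts` with `F` counting forward visits to `A`, `D` counting those
to `A \ G`, and the good times being the visits to `G`. The sparse past makes the two-sided estimate
at `y` one-sided. -/
theorem false_of_sparse_gap {b : ℕ → ℝ} (hb : Monotone b) {N k : ℕ} (hN : 1 ≤ N)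
    (hG : ∀ x ∈ G, ∀ n ≥ N,
      99 / 100 * b n ≤ symmSum T (ind A) n x ∧ symmSum T (ind A) n x ≤ b n)
    {y : X} (hy : y ∈ G) (hbad : symmSum T (ind (A \ G)) (k + 1) y ≤ b (k + 1) / 100)
    (hgap : ∑ j ∈ Finset.range k, ind A (T.symm^[j + 1] y) ≤ b (k + 1) / 100)
    (hNk : N ≤ k + 1) (hbk : 100 * (N + 1 : ℝ) ≤ b (k + 1)) : False := by
  refine false_of_window_counts (F := fun n => birkhoffSum T (ind A) n y)
    (D := fun n => birkhoffSum T (ind (A \ G)) n y) (b := b) (g := fun s => T^[s] y ∈ G)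
    (N := N) (ℓ := k + 1) hN rfl rfl (monotone_birkhoffSum_ind T A y) (fun n => ?_)
    (monotone_birkhoffSum_ind T (A \ G) y) (fun n => ?_) hb (fun s hs n hn hns => ?_) (fun n hn => ?_)
    (fun n hn hnk => ?_) ?_ hNk hbk
  · simp only [birkhoffSum_succ]
    linarith [ind_le_one A (T^[n] y)]
  · by_cases hg : T^[n] y ∈ G
    · exact Or.inl hg
    · right
      simp only [birkhoffSum_succ, add_sub_cancel_left]
      by_cases hA : T^[n] y ∈ A
      · have h1 : T^[n] y ∈ A \ G := ⟨hA, hg⟩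
        rw [ind_of_mem hA, ind_of_mem h1]
      · rw [ind_of_notMem hA]
        exact ind_nonneg _ _
  · have := hG _ hs n hn
    rwa [symmSum_iterate_eq T _ (hN.trans hn) hns] at this
  · refine le_trans ?_ (hG y hy n hn).2
    obtain ⟨n, rfl⟩ : ∃ k, n = k + 1 := ⟨n - 1, by omega⟩
    rw [symmSum_succ_eq_add_sum]
    exact le_add_of_nonneg_right (Finset.sum_nonneg fun _ _ => ind_nonneg _ _)
  · have h1 := (hG y hy n hn).1
    obtain ⟨n, rfl⟩ : ∃ k, n = k + 1 := ⟨n - 1, by omega⟩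
    rw [symmSum_succ_eq_add_sum] at h1
    have h2 : ∑ j ∈ Finset.range n, ind A (T.symm^[j + 1] y) ≤
        ∑ j ∈ Finset.range k, ind A (T.symm^[j + 1] y) :=
      Finset.sum_le_sum_of_subset_of_nonneg (Finset.range_mono (by omega)) fun _ _ _ =>
        ind_nonneg _ _
    linarith
  · refine le_trans ?_ hbad
    rw [symmSum_succ_eq_add_sum]
    exact le_add_of_nonneg_right (Finset.sum_nonneg fun _ _ => ind_nonneg _ _)

theorem measurableSet_forall_ge {p : ℕ → X → Prop} (hp : ∀ n, MeasurableSet {x | p n x}) (N : ℕ) :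
    MeasurableSet {x | ∀ n ≥ N, p n x} := by
  have : {x | ∀ n ≥ N, p n x} = ⋂ n, ⋂ (_ : n ≥ N), {x | p n x} := by ext x; simp
  rw [this]
  exact MeasurableSet.iInter fun n => MeasurableSet.iInter fun _ => hp n

/-- A property which holds eventually, almost everywhere, holds uniformly from some index on
outside a subset of small measure of a given set of finite measure. -/
theorem exists_measure_sdiff_le {p : ℕ → X → Prop} (hp : ∀ n, MeasurableSet {x | p n x})
    (hae : ∀ᵐ x ∂m, ∀ᶠ n in atTop, p n x) (hA : MeasurableSet A) (ht : m A < ⊤) {ε : ENNReal}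
    (hε : 0 < ε) : ∃ N, m (A \ {x | ∀ n ≥ N, p n x}) ≤ ε := by
  have hm := measurableSet_forall_ge hp
  have h0 : m (⋂ N, A \ {x | ∀ n ≥ N, p n x}) = 0 := by
    refine measure_eq_zero_iff_ae_notMem.2 ?_
    filter_upwards [hae] with x hx hx'
    obtain ⟨N, hN⟩ := eventually_atTop.1 hx
    exact (Set.mem_iInter.1 hx' N).2 hN
  have h1 : Tendsto (fun N => m (A \ {x | ∀ n ≥ N, p n x})) atTop (𝓝 0) := by
    rw [← h0]
    refine tendsto_measure_iInter_atTop (fun N => (hA.diff (hm N)).nullMeasurableSet) ?_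
      ⟨0, ((measure_mono Set.sdiff_subset).trans_lt ht).ne⟩
    intro N N' hNN x hx
    exact ⟨hx.1, fun h => hx.2 fun n hn => h n (hNN.trans hn)⟩
  obtain ⟨N, hN⟩ := (ENNReal.tendsto_nhds_zero.1 h1 ε hε).exists
  exact ⟨N, hN⟩

theorem IsBoundedSet.le_sub_of_limsup_liminf (h : IsBoundedSet T m A M) (hT : Ergodic T m)
    (hc : Conservative T m) (hinf : m Set.univ = ⊤) {β β' : ℝ}
    (hβ : ∀ f : X → ℝ, Integrable f m → 0 ≤ᵐ[m] f → ∀ᵐ x ∂m,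
      limsup (fun n => ((symmSum T f n x / (2 * returnSeq T m A n) : ℝ) : EReal)) atTop =
        ((β * ∫ y, f y ∂m : ℝ) : EReal))
    (hβ' : ∀ᵐ x ∂m,
      liminf (fun n => ((symmSum T (ind A) n x / (2 * returnSeq T m A n) : ℝ) : EReal)) atTop =
        ((β' * m.real A : ℝ) : EReal)) :
    1 / 5000 ≤ β - β' := by
  by_contra! hlt
  have hA := h.measurableSet
  have hAt := h.measure_lt_top
  set μ := m.real A with hμdef
  have hμ : 0 < μ := h.real_pos
  obtain ⟨-, ha⟩ := h.pos_and_tendsto hT hc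
  have hind : ∀ B : Set X, 0 ≤ᵐ[m] ind B := fun B => ae_of_all _ (ind_nonneg B)
  have hβA := hβ (ind A) (integrable_ind hA hAt) (hind A)
  rw [integral_ind hA] at hβA
  have hβ1 : 1 ≤ β := by
    have := h.measure_le_of_limsup hT hc hβA
    nlinarith
  -- Slightly above the limsup, so that `b` eventually bounds the two-sided counts from above.
  set b : ℕ → ℝ := fun n => (β + 1 / 5000) * μ * (2 * returnSeq T m A n) with hb
  have hcpos : 0 < (β + 1 / 5000) * μ := by positivity
  have hbmono : Monotone b := fun i j hij =>
    mul_le_mul_of_nonneg_left (mul_le_mul_of_nonneg_left (monotone_returnSeq T m A hij)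
      zero_le_two) hcpos.le
  have hbtop : Tendsto b atTop atTop := (ha.const_mul_atTop two_pos).const_mul_atTop hcpos
  have hevG : ∀ᵐ x ∂m, ∀ᶠ n in atTop,
      99 / 100 * b n ≤ symmSum T (ind A) n x ∧ symmSum T (ind A) n x ≤ b n := by
    filter_upwards [hβA, hβ'] with x h1 h2
    have h3 : limsup (fun n => ((symmSum T (ind A) n x / (2 * returnSeq T m A n) : ℝ) : EReal))
        atTop < (((β + 1 / 5000) * μ : ℝ) : EReal) := by
      rw [h1, EReal.coe_lt_coe_iff]
      nlinarith
    have h4 : (((β' - 1 / 5000) * μ : ℝ) : EReal) < liminf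
        (fun n => ((symmSum T (ind A) n x / (2 * returnSeq T m A n) : ℝ) : EReal)) atTop := by
      rw [h2, EReal.coe_lt_coe_iff]
      nlinarith
    filter_upwards [eventually_lt_of_limsup_lt h3, eventually_lt_of_lt_liminf h4,
      ha.eventually_gt_atTop 0] with n h5 h6 h7
    rw [EReal.coe_lt_coe_iff] at h5 h6
    rw [div_lt_iff₀ (by linarith)] at h5
    rw [lt_div_iff₀ (by linarith)] at h6
    refine ⟨le_trans ?_ h6.le, h5.le⟩
    -- Uses `1 ≤ β`: the assumed closeness costs less than 3/5000, well within one percent of `β`.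
    have h8 : 99 / 100 * (β + 1 / 5000) ≤ β' - 1 / 5000 := by linarith
    have h9 := mul_le_mul_of_nonneg_right h8 (mul_pos hμ (mul_pos two_pos h7)).le
    simp only [hb]
    linarith
  have hsm : ∀ {B : Set X}, MeasurableSet B → ∀ n, Measurable (symmSum T (ind B) n) :=
    fun hB n => measurable_symmSum T (measurable_ind hB) n
  have hpG : ∀ n, MeasurableSet {x | 99 / 100 * b n ≤ symmSum T (ind A) n x ∧
      symmSum T (ind A) n x ≤ b n} := fun n =>
    (measurableSet_le measurable_const (hsm hA n)).inter (measurableSet_le (hsm hA n)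
      measurable_const)
  obtain ⟨N₀, hN₀⟩ := exists_measure_sdiff_le hpG hevG hA hAt
    (ε := ENNReal.ofReal (μ / 100)) (by rw [ENNReal.ofReal_pos]; positivity)
  set G : Set X := A ∩ {x | ∀ n ≥ N₀, 99 / 100 * b n ≤ symmSum T (ind A) n x ∧
      symmSum T (ind A) n x ≤ b n} with hGdef
  have hG : MeasurableSet G := hA.inter (measurableSet_forall_ge hpG N₀)
  have hGA : G ⊆ A := Set.inter_subset_left
  have hbadm : m.real (A \ G) ≤ μ / 100 := by
    have : A \ G = A \ {x | ∀ n ≥ N₀, 99 / 100 * b n ≤ symmSum T (ind A) n x ∧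
      symmSum T (ind A) n x ≤ b n} := Set.sdiff_self_inter
    rw [this]
    exact ENNReal.toReal_le_of_le_ofReal (by positivity) hN₀
  have hB : MeasurableSet (A \ G) := hA.diff hG
  have hBt : m (A \ G) < ⊤ := (measure_mono Set.sdiff_subset).trans_lt hAt
  have hevH : ∀ᵐ x ∂m, ∀ᶠ n in atTop, symmSum T (ind (A \ G)) n x ≤ b n / 100 := by
    filter_upwards [hβ (ind (A \ G)) (integrable_ind hB hBt) (hind _)] with x h1
    rw [integral_ind hB] at h1
    have h3 : limsup (fun n => ((symmSum T (ind (A \ G)) n x / (2 * returnSeq T m A n) : ℝ) :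
        EReal)) atTop < (((β + 1 / 5000) * μ / 100 : ℝ) : EReal) := by
      rw [h1, EReal.coe_lt_coe_iff]
      nlinarith
    filter_upwards [eventually_lt_of_limsup_lt h3, ha.eventually_gt_atTop 0] with n h5 h7
    rw [EReal.coe_lt_coe_iff, div_lt_iff₀ (by linarith)] at h5
    simp only [hb]
    linarith
  have hpH : ∀ n, MeasurableSet {x | symmSum T (ind (A \ G)) n x ≤ b n / 100} := fun n =>
    measurableSet_le (hsm hB n) measurable_const
  have hG0 : 0 < m G := by
    have h1 : m.real G = μ - m.real (A \ G) := by
      have := measureReal_sdiff hGA hG (μ := m)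
      linarith
    have h2 : 0 < m.real G := by linarith
    exact pos_iff_ne_zero.2 fun h0 => by simp [Measure.real, h0] at h2
  have hGt : m G < ⊤ := (measure_mono hGA).trans_lt hAt
  obtain ⟨N₁, hN₁⟩ := exists_measure_sdiff_le hpH hevH hG hGt (ε := m G / 2)
    (ENNReal.half_pos hG0.ne')
  -- Starting points in `H` also see few bad visits, because `A \ G` has measure at most `μ / 100`
  -- and the upper constant applies to its indicator.
  set H : Set X := G ∩ {x | ∀ n ≥ N₁, symmSum T (ind (A \ G)) n x ≤ b n / 100} with hHdef
  have hH : MeasurableSet H := hG.inter (measurableSet_forall_ge hpH N₁)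
  have hH0 : m H ≠ 0 := by
    intro h0
    have h1 : m G ≤ m G / 2 := by
      calc m G ≤ m H + m (G \ {x | ∀ n ≥ N₁, symmSum T (ind (A \ G)) n x ≤ b n / 100}) :=
            (measure_mono (Set.inter_union_sdiff G _).symm.subset).trans (measure_union_le _ _)
        _ ≤ m G / 2 := by rw [h0, zero_add]; exact hN₁
    exact absurd h1 (not_le.2 (ENNReal.half_lt_self hG0.ne' hGt.ne))
  set N := max (max N₀ N₁) 1 with hN
  obtain ⟨K, hK⟩ := eventually_atTop.1 (hbtop.eventually_ge_atTop (100 * (N + 1 : ℝ)))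
  -- This `C` turns the sparse-gap bound into `b (k + 1) / 100`: the factor 50 becomes 100 through
  -- the 2 in `b`.
  obtain ⟨k, hk, y, hy, hgap⟩ := h.exists_sparse_gap hT hc hinf hH
    (Set.inter_subset_left.trans hGA) hH0 (C := 50 / ((β + 1 / 5000) * μ)) (by positivity)
    (max K N)
  have hkK : K ≤ k + 1 := ((le_max_left K N).trans hk).trans (Nat.le_succ k)
  have hkN : N ≤ k + 1 := ((le_max_right K N).trans hk).trans (Nat.le_succ k)
  refine false_of_sparse_gap (T := T) hbmono (le_max_right _ _)
    (fun x hx n hn => hx.2 n (le_trans ?_ hn)) hy.1 (hy.2 (k + 1) (le_trans ?_ hkN)) ?_ hkN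
    (hK (k + 1) hkK)
  · exact (le_max_left N₀ N₁).trans (le_max_left _ _)
  · exact (le_max_right N₀ N₁).trans (le_max_left _ _)
  · rw [div_mul_eq_mul_div, div_lt_iff₀ hcpos] at hgap
    simp only [hb]
    linarith

end Gap

end SymmetricBirkhoff

theorem theorem2 {X : Type*} [MeasurableSpace X] (m : Measure X) [SigmaFinite m]
    (T : X ≃ᵐ X) (h_inf : m Set.univ = ⊤) (h_erg : Ergodic T m) (h_cons : Conservative T m)
    (h_bre : SymmetricBirkhoff.BoundedlyRationallyErgodic T m) :
    ∃ βlower βupper : ℝ, SymmetricBirkhoff.IsLowerBeta T m βlower ∧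
      SymmetricBirkhoff.IsUpperBeta T m βupper ∧ (1 / 5000 : ℝ) ≤ βupper - βlower := by
  obtain ⟨β, β', hβ, hβ'⟩ :=
    SymmetricBirkhoff.exists_isUpperBeta_isLowerBeta h_erg h_cons h_bre
  obtain ⟨A, hA⟩ := h_bre
  obtain ⟨M, hAM⟩ := hA.exists_isBoundedSet h_erg.toMeasurePreserving
  refine ⟨β', β, hβ', hβ, hAM.le_sub_of_limsup_liminf h_erg h_cons h_inf (hβ _ ⟨A, hA, rfl⟩) ?_⟩
  have := hβ' _ ⟨A, hA, rfl⟩ (SymmetricBirkhoff.ind A)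
    (SymmetricBirkhoff.integrable_ind hA.measurableSet hA.measure_lt_top)
    (ae_of_all _ (SymmetricBirkhoff.ind_nonneg A))
  rwa [SymmetricBirkhoff.integral_ind hA.measurableSet] at this
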